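/- Let $(a_N)$ be a real sequence with $a_N\to\infty$. For each $N$ let $\mathcal H^{(N)}$ be a complex Hilbert space, $\mathcal X^{(N)}$ a measurable space (the alphabet) and $W^{(N)}:x\mapsto W^{(N)}_x$ a classical-quantum channel, i.e. a (strongly) measurable map from $\mathcal X^{(N)}$ to the density operators on $\mathcal H^{(N)}$; write $\boldsymbol W=\{W^{(N)}\}$. For a compact self-adjoint operator $A=\sum_i x_iE_i$ (spectral decomposition) and $S\subset\mathbb R$ put $\{A\in S\}:=\sum_{i:\,x_i\in S}E_i$. For a sequence $\boldsymbol P=\{P^{(N)}\}$ of probability distributions on $\mathcal X^{(N)}$ let $W^{(N)}_{P^{(N)}}:=\int W^{(N)}_x\,P^{(N)}(dx)$ and $\boldsymbol{W_P}:=\{W^{(N)}_{P^{(N)}}\}$. For $0\le\epsilon<1$ define, as extended real numbers, $$I(\epsilon|\boldsymbol P,\boldsymbol W):=\sup\Bigl\{b\in\mathbb R\Bigm|\limsup_{N\to\infty}\int_{\mathcal X^{(N)}}\operatorname{Tr}W^{(N)}_x\{W^{(N)}_x-e^{a_Nb}W^{(N)}_{P^{(N)}}\le0\}\,P^{(N)}(dx)\le\epsilon\Bigr\},$$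 $$\overline H_+(\epsilon|\boldsymbol\rho):=\sup\Bigl\{b\in\mathbb R\Bigm|\limsup_{N\to\infty}\operatorname{Tr}\rho^{(N)}\bigl\{\tfrac{-1}{a_N}\log\rho^{(N)}\le b\bigr\}\le\epsilon\Bigr\}$$ for a sequence $\boldsymbol\rho=\{\rho^{(N)}\}$ of density operators (with $-\log0=+\infty$), and $$C(\epsilon|\boldsymbol W):=\sup_{\{\Phi_N\}}\Bigl\{\liminf_{N\to\infty}\frac{\log|\Phi_N|}{a_N}\Bigm|\lim_{N\to\infty}\varepsilon[\Phi_N]\le\epsilon\Bigr\}.$$ Here a code $\Phi_N=(M_N,\varphi_N,Y^N)$ consists of a size $|\Phi_N|=M_N\ge1$, an encoder $\varphi_N:\{1,\dots,M_N\}\to\mathcal X^{(N)}$ and a POVM $Y^N=\{Y^N_i\}_{i=1}^{M_N}$ on $\mathcal H^{(N)}$, and $\varepsilon[\Phi_N]=\frac1{M_N}\sum_i\operatorname{Tr}W^{(N)}_{\varphi_N(i)}(I-Y^N_i)$; the supremum is over sequences of codes for which the limit of $\varepsilon[\Phi_N]$ exists and is at most $\epsilon$. **Theorem 3.** Assume that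 $W^{(N)}_x$ is a pure state for all $N$ and all $x\in\mathcal X^{(N)}$, and let $0\le\epsilon<1$. Then $$\overline H_+(\epsilon|\boldsymbol{W_P})=I(\epsilon|\boldsymbol P,\boldsymbol W)$$ for every sequence $\boldsymbol P$ of probability distributions, and $$C(\epsilon|\boldsymbol W)=\sup_{\boldsymbol P}\overline H_+(\epsilon|\boldsymbol{W_P}).$$ -/

import Mathlib

open MeasureTheory Filter Topology
open scoped InnerProductSpace

noncomputable section

namespace CQ

universe u v

section Operators

variable {H : Type u} [NormedAddCommGroup H] [InnerProductSpace ℂ H] [CompleteSpace H]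

/-- The trace `∑ i, ⟪e i, A e i⟫` of an operator, computed in a fixed orthonormal (Hilbert) basis
of the space. For a trace-class operator the sum converges absolutely and does not depend on the
basis; below, the trace is only applied to trace-class operators. -/
def trace (A : H →L[ℂ] H) : ℂ :=
  ∑' i : (exists_hilbertBasis ℂ H).choose,
    ⟪(exists_hilbertBasis ℂ H).choose_spec.choose i,
      A ((exists_hilbertBasis ℂ H).choose_spec.choose i)⟫_ℂ

/-- The number `Tr (ρ T)`: the probability of the effect `T` in the state `ρ`. -/
def prob (ρ T : H →L[ℂ] H) : ℝ := (trace (ρ * T)).re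

/-- Density operators: positive operators of trace one. (A positive operator that is not of trace
class has a divergent trace sum, whose value is `0` by convention, so it is excluded.) -/
def IsDensityOperator (ρ : H →L[ℂ] H) : Prop :=
  ρ.IsPositive ∧ trace ρ = 1

/-- Pure states: the operators `|ψ⟩⟨ψ|` with `ψ` a unit vector. -/
def IsPureState (ρ : H →L[ℂ] H) : Prop :=
  ∃ ψ : H, ‖ψ‖ = 1 ∧ ρ = InnerProductSpace.rankOne ℂ ψ ψ

/-- The spectral projection `{A ∈ S} = ∑_{i : xᵢ ∈ S} Eᵢ` of a compact self-adjoint operator with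
spectral decomposition `A = ∑ᵢ xᵢ Eᵢ`: the orthogonal projection onto the closed span of the
eigenspaces of `A` whose eigenvalue lies in `S` (the kernel is the eigenspace of `0`). -/
def specProj (A : H →L[ℂ] H) (S : Set ℝ) : H →L[ℂ] H :=
  (⨆ x ∈ S, Module.End.eigenspace (A : H →ₗ[ℂ] H) (x : ℂ)).topologicalClosure.starProjection

end Operators

/-- A classical-quantum channel with input alphabet `X` and output space `H`: a (measurable) map
from letters to density operators. -/
structure Channel (X : Type v) [MeasurableSpace X] (H : Type u) [NormedAddCommGroup H]
    [InnerProductSpace ℂ H] [CompleteSpace H] where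
  /-- the output state `W_x` -/
  out : X → H →L[ℂ] H
  isDensityOperator : ∀ x, IsDensityOperator (out x)
  stronglyMeasurable : StronglyMeasurable out

/-- A code with at least one message: an encoder and a decoding POVM. -/
structure Code (X : Type v) (H : Type u) [NormedAddCommGroup H]
    [InnerProductSpace ℂ H] [CompleteSpace H] where
  /-- the number of messages -/
  size : ℕ
  size_pos : 0 < size
  encoder : Fin size → X
  decoder : Fin size → H →L[ℂ] H
  decoder_isPositive : ∀ i, (decoder i).IsPositive
  decoder_sum : ∑ i, decoder i = 1

section Single

variable {X : Type v} [MeasurableSpace X] {H : Type u} [NormedAddCommGroup H]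
  [InnerProductSpace ℂ H] [CompleteSpace H]

/-- The averaged output state `W_P = ∫ W_x P(dx)` (a Bochner integral of operators). -/
def Channel.avg (W : Channel X H) (P : ProbabilityMeasure X) : H →L[ℂ] H :=
  ∫ x, W.out x ∂(P : Measure X)

/-- The average error probability of a code. -/
def Code.error (Φ : Code X H) (W : Channel X H) : ℝ :=
  (1 / (Φ.size : ℝ)) * ∑ i, prob (W.out (Φ.encoder i)) (1 - Φ.decoder i)

end Single

section Sequences

variable {X : ℕ → Type v} [∀ N, MeasurableSpace (X N)] {H : ℕ → Type u}
  [∀ N, NormedAddCommGroup (H N)] [∀ N, InnerProductSpace ℂ (H N)] [∀ N, CompleteSpace (H N)]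

/-- The `ε`-capacity `C(ε|W)` with normalization `a`: the supremum of the rates
`liminf (log |Φ_N|) / a_N` over the sequences of codes whose average error probability converges
to a limit at most `ε`. -/
def capacity (a : ℕ → ℝ) (ε : ℝ) (W : ∀ N, Channel (X N) (H N)) : EReal :=
  sSup {R : EReal | ∃ Φ : ∀ N, Code (X N) (H N),
    (∃ l : ℝ, l ≤ ε ∧ Tendsto (fun N => (Φ N).error (W N)) atTop (𝓝 l)) ∧
    R = liminf (fun N => ((Real.log (Φ N).size / a N : ℝ) : EReal)) atTop}

/-- The information-spectrum quantity `I(ε|P,W)`: the supremum of the real numbers `b` with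
`limsup ∫ Tr W_x {W_x - exp (a_N b) W_P ≤ 0} P(dx) ≤ ε`. -/
def infoSpectrum (a : ℕ → ℝ) (ε : ℝ) (P : ∀ N, ProbabilityMeasure (X N))
    (W : ∀ N, Channel (X N) (H N)) : EReal :=
  sSup {r : EReal | ∃ b : ℝ, r = (b : EReal) ∧
    limsup (fun N => ((∫ x, prob ((W N).out x)
        (specProj ((W N).out x - ((Real.exp (a N * b) : ℝ) : ℂ) • (W N).avg (P N)) (Set.Iic 0))
      ∂(P N : Measure (X N)) : ℝ) : EReal)) atTop ≤ (ε : EReal)}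

/-- The sup-entropy spectrum quantity of a sequence of density operators: the supremum of the
real numbers `b` with `limsup Tr ρ_N {-(1 / a_N) log ρ_N ≤ b} ≤ ε`. An eigenvalue `0` of `ρ_N` has
`-log 0 = +∞`, so it never belongs to the set `{-(1 / a_N) log ρ_N ≤ b}`. -/
def supEntropySpectrum (a : ℕ → ℝ) (ε : ℝ) (ρ : ∀ N, H N →L[ℂ] H N) : EReal :=
  sSup {r : EReal | ∃ b : ℝ, r = (b : EReal) ∧
    limsup (fun N => ((prob (ρ N)
        (specProj (ρ N) {x : ℝ | 0 < x ∧ (-1 / a N) * Real.log x ≤ b}) : ℝ) : EReal)) atTop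
      ≤ (ε : EReal)}

end Sequences

end CQ

end

/-! For a pure state `|ψ⟩⟨ψ|` and a compact positive `ρ`, the test `{|ψ⟩⟨ψ| - cρ ≤ 0}` behaves on
`ψ` like the eigenvalue test `{ρ ≥ t}` with `t` near `1/c`. Its probability exceeds the other by at
most `c * t` (`prob_specProj_sub_smul_le`), and falls short by at most `2 * s` if `c * t * s ^ 2 ≥
1` (`prob_specProj_le`). With `ρ = W_P`, averaging over `x` turns the eigenvalue test into `Tr W_P
{W_P ≥ t}`. On the exponential scale a shift of `b` by `δ > 0` makes both errors vanish, and suprema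
over `b` do not see such shifts. This gives the first identity.

The capacity formula is proved directly with `E = {W_P ≥ t}`.

Achievability (`exists_code_error_le`): the test for a letter `x` is the projection onto the
normalized part of `ψ_x` orthogonal to `E`. It detects `ψ_x` with probability `1 - ‖E ψ_x‖²` and has
probability at most `t` in the state `W_P`. Under sequential decoding, message `i` is disturbed only
by the tests before it, so codewords can be chosen greedily, and the error is at most `Tr W_P E + κ
+ M t / κ`. Mixing in the uniform decoder makes the errors converge, to exactly `ε`.

Converse (`exists_prob_specProj_le_error`): let `P` be uniform on the codewords. Then `E` has rank
at most `1/t`, and since the decoder sums to the identity, the total success probability supported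
on the range of `E` is at most this rank. Hence `Tr W_P E` exceeds the error by at most `κ + (1 +
κ⁻¹) / (M t)`. -/

namespace CQ

/-! ### Spectral projections of compact self-adjoint operators. -/

section Spectral

variable {H : Type*} [NormedAddCommGroup H] [InnerProductSpace ℂ H]

/-- The span of the eigenspaces of `A` with eigenvalue in `S`. -/
def spectralSpan (A : H →L[ℂ] H) (S : Set ℝ) : Submodule ℂ H :=
  ⨆ x ∈ S, Module.End.eigenspace (A : H →ₗ[ℂ] H) (x : ℂ)

theorem eigenspace_le_spectralSpan (A : H →L[ℂ] H) {S : Set ℝ} {x : ℝ} (hx : x ∈ S) :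
    Module.End.eigenspace (A : H →ₗ[ℂ] H) (x : ℂ) ≤ spectralSpan A S :=
  le_iSup₂_of_le x hx le_rfl

theorem apply_mem_spectralSpan (A : H →L[ℂ] H) {S : Set ℝ} {v : H} (hv : v ∈ spectralSpan A S) :
    A v ∈ spectralSpan A S := by
  have h : spectralSpan A S ≤ (spectralSpan A S).comap (A : H →ₗ[ℂ] H) := by
    refine iSup₂_le fun x hx v hv => ?_
    have h1 : A v = (x : ℂ) • v := by simpa using Module.End.mem_eigenspace_iff.1 hv
    simpa [h1] using (spectralSpan A S).smul_mem (x : ℂ) (eigenspace_le_spectralSpan A hx hv)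
  exact h hv

theorem apply_mem_closure_spectralSpan (A : H →L[ℂ] H) {S : Set ℝ} {v : H}
    (hv : v ∈ (spectralSpan A S).topologicalClosure) :
    A v ∈ (spectralSpan A S).topologicalClosure :=
  map_mem_closure A.continuous hv fun _ => apply_mem_spectralSpan A

theorem exists_finset_of_mem_spectralSpan {A : H →L[ℂ] H} {S : Set ℝ} {v : H}
    (hv : v ∈ spectralSpan A S) :
    ∃ (s : Finset S) (f : S → H), (∀ x : S, A (f x) = ((x : ℝ) : ℂ) • f x) ∧ ∑ x ∈ s, f x = v := by
  rw [spectralSpan, iSup_subtype', Submodule.mem_iSup_iff_exists_finsupp] at hv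
  obtain ⟨f, hf, rfl⟩ := hv
  exact ⟨f.support, f, fun x => by simpa using Module.End.mem_eigenspace_iff.1 (hf x), rfl⟩

variable {A : H →L[ℂ] H}

theorem inner_eq_zero_of_eigenvalue_ne (hA : (A : H →ₗ[ℂ] H).IsSymmetric) {x y : ℝ} (hxy : x ≠ y)
    {u v : H} (hu : A u = (x : ℂ) • u) (hv : A v = (y : ℂ) • v) : ⟪u, v⟫_ℂ = 0 := by
  have h := hA u v
  simp only [ContinuousLinearMap.coe_coe, hu, hv, inner_smul_left, inner_smul_right,
    Complex.conj_ofReal] at h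
  have h2 : ((x : ℂ) - y) * ⟪u, v⟫_ℂ = 0 := by rw [sub_mul, h, sub_self]
  rcases mul_eq_zero.1 h2 with h3 | h3
  · exact absurd (by exact_mod_cast sub_eq_zero.1 h3) hxy
  · exact h3

/-- Eigenvectors for distinct eigenvalues are orthogonal, so both quadratic forms are diagonal in
the eigencomponents. Bounds on the eigenvalues in `S` then bound the quadratic form, first on the
span and by continuity on its closure. -/
theorem exists_inner_apply_eq_of_mem_spectralSpan (hA : (A : H →ₗ[ℂ] H).IsSymmetric) {S : Set ℝ}
    {v : H} (hv : v ∈ spectralSpan A S) :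
    ∃ (s : Finset S) (f : S → H), ‖v‖ ^ 2 = ∑ x ∈ s, ‖f x‖ ^ 2 ∧
      (⟪v, A v⟫_ℂ).re = ∑ x ∈ s, (x : ℝ) * ‖f x‖ ^ 2 := by
  obtain ⟨s, f, hf, rfl⟩ := exists_finset_of_mem_spectralSpan hv
  -- Used with `c = 1` for the norm and with `c x = x` for the quadratic form.
  have key : ∀ c : S → ℂ, ⟪∑ x ∈ s, f x, ∑ x ∈ s, c x • f x⟫_ℂ = ∑ x ∈ s, c x * (‖f x‖ : ℂ) ^ 2 := by
    intro c
    rw [sum_inner]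
    refine Finset.sum_congr rfl fun x hx => ?_
    rw [inner_sum, Finset.sum_eq_single x]
    · rw [inner_smul_right, inner_self_eq_norm_sq_to_K]; rfl
    · intro y _ hyx
      rw [inner_smul_right, inner_eq_zero_of_eigenvalue_ne hA
        (fun h => hyx (Subtype.ext h.symm)) (hf x) (hf y), mul_zero]
    · exact fun h => absurd hx h
  refine ⟨s, f, ?_, ?_⟩
  · have h := key fun _ => 1
    simp only [one_smul, one_mul] at h
    rw [inner_self_eq_norm_sq_to_K] at h
    refine Complex.ofReal_injective ?_
    push_cast
    exact h
  · rw [map_sum, Finset.sum_congr rfl fun x _ => hf x, key]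
    rw [Complex.re_sum]
    refine Finset.sum_congr rfl fun x _ => ?_
    norm_cast

theorem le_re_inner_apply_of_mem_closure (hA : (A : H →ₗ[ℂ] H).IsSymmetric) {S : Set ℝ} {t : ℝ}
    (ht : ∀ x ∈ S, t ≤ x) {v : H} (hv : v ∈ (spectralSpan A S).topologicalClosure) :
    t * ‖v‖ ^ 2 ≤ (⟪v, A v⟫_ℂ).re := by
  have hc : IsClosed {v : H | t * ‖v‖ ^ 2 ≤ (⟪v, A v⟫_ℂ).re} :=
    isClosed_le (by fun_prop) (by fun_prop)
  refine closure_minimal (fun w hw => ?_) hc hv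
  obtain ⟨s, f, h1, h2⟩ := exists_inner_apply_eq_of_mem_spectralSpan hA hw
  rw [Set.mem_ofPred_eq, h1, h2, Finset.mul_sum]
  exact Finset.sum_le_sum fun x _ => mul_le_mul_of_nonneg_right (ht x x.2) (sq_nonneg _)

theorem re_inner_apply_le_of_mem_closure (hA : (A : H →ₗ[ℂ] H).IsSymmetric) {S : Set ℝ} {t : ℝ}
    (ht : ∀ x ∈ S, x ≤ t) {v : H} (hv : v ∈ (spectralSpan A S).topologicalClosure) :
    (⟪v, A v⟫_ℂ).re ≤ t * ‖v‖ ^ 2 := by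
  have hc : IsClosed {v : H | (⟪v, A v⟫_ℂ).re ≤ t * ‖v‖ ^ 2} :=
    isClosed_le (by fun_prop) (by fun_prop)
  refine closure_minimal (fun w hw => ?_) hc hv
  obtain ⟨s, f, h1, h2⟩ := exists_inner_apply_eq_of_mem_spectralSpan hA hw
  rw [Set.mem_ofPred_eq, h1, h2, Finset.mul_sum]
  exact Finset.sum_le_sum fun x _ => mul_le_mul_of_nonneg_right (ht x x.2) (sq_nonneg _)

theorem iSup_eigenspace_le_spectralSpan_univ (hA : (A : H →ₗ[ℂ] H).IsSymmetric) :
    ⨆ μ, Module.End.eigenspace (A : H →ₗ[ℂ] H) μ ≤ spectralSpan A Set.univ := by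
  refine iSup_le fun μ => ?_
  by_cases h : Module.End.eigenspace (A : H →ₗ[ℂ] H) μ = ⊥
  · simp [h]
  · have h1 : (starRingEnd ℂ) μ = μ :=
      hA.conj_eigenvalue_eq_self (Module.End.hasEigenvalue_iff.2 h)
    obtain ⟨r, rfl⟩ := Complex.conj_eq_iff_real.1 h1
    exact eigenspace_le_spectralSpan A (Set.mem_univ r)

theorem spectralSpan_le_orthogonal_compl (hA : (A : H →ₗ[ℂ] H).IsSymmetric) (S : Set ℝ) :
    spectralSpan A Sᶜ ≤ (spectralSpan A S)ᗮ := by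
  refine iSup₂_le fun y hy v hv => ?_
  have hv' : A v = (y : ℂ) • v := by simpa using Module.End.mem_eigenspace_iff.1 hv
  have : spectralSpan A S ≤ (ℂ ∙ v)ᗮ := by
    refine iSup₂_le fun x hx u hu => ?_
    have hu' : A u = (x : ℂ) • u := by simpa using Module.End.mem_eigenspace_iff.1 hu
    rw [Submodule.mem_orthogonal_singleton_iff_inner_right]
    exact inner_eq_zero_of_eigenvalue_ne hA (fun h : y = x => hy (h ▸ hx)) hv' hu'
  rw [Submodule.mem_orthogonal]
  intro u hu
  exact Submodule.mem_orthogonal_singleton_iff_inner_left.1 (this hu)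

variable [CompleteSpace H]

theorem specProj_eq (A : H →L[ℂ] H) (S : Set ℝ) :
    specProj A S = (spectralSpan A S).topologicalClosure.starProjection := rfl

theorem specProj_apply_mem (A : H →L[ℂ] H) (S : Set ℝ) (v : H) :
    specProj A S v ∈ (spectralSpan A S).topologicalClosure :=
  Submodule.starProjection_apply_mem _ v

theorem le_re_inner_specProj (hA : (A : H →ₗ[ℂ] H).IsSymmetric) {S : Set ℝ} {t : ℝ}
    (ht : ∀ x ∈ S, t ≤ x) (v : H) :
    t * ‖specProj A S v‖ ^ 2 ≤ (⟪specProj A S v, A (specProj A S v)⟫_ℂ).re :=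
  le_re_inner_apply_of_mem_closure hA ht (specProj_apply_mem A S v)

theorem re_inner_specProj_le (hA : (A : H →ₗ[ℂ] H).IsSymmetric) {S : Set ℝ} {t : ℝ}
    (ht : ∀ x ∈ S, x ≤ t) (v : H) :
    (⟪specProj A S v, A (specProj A S v)⟫_ℂ).re ≤ t * ‖specProj A S v‖ ^ 2 :=
  re_inner_apply_le_of_mem_closure hA ht (specProj_apply_mem A S v)

/-- The only place where compactness enters the complement formula: eigenvectors are total, and
their eigenvalues are real, so each lies in `S` or in its complement. -/
theorem spectralSpan_orthogonal_inf_compl (hc : IsCompactOperator A)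
    (hA : (A : H →ₗ[ℂ] H).IsSymmetric) (S : Set ℝ) :
    (spectralSpan A S)ᗮ ⊓ (spectralSpan A Sᶜ)ᗮ = ⊥ := by
  rw [Submodule.inf_orthogonal, eq_bot_iff,
    ← ContinuousLinearMap.orthogonalComplement_iSup_eigenspaces_eq_bot hc hA]
  refine Submodule.orthogonal_le ((iSup_eigenspace_le_spectralSpan_univ hA).trans ?_)
  refine iSup₂_le fun x _ => ?_
  by_cases hx : x ∈ S
  · exact (eigenspace_le_spectralSpan A hx).trans le_sup_left
  · exact (eigenspace_le_spectralSpan A (S := Sᶜ) hx).trans le_sup_right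

/-- The spectral projections of a compact self-adjoint operator on complementary sets add up
to the identity. -/
theorem specProj_compl (hc : IsCompactOperator A) (hA : (A : H →ₗ[ℂ] H).IsSymmetric) (S : Set ℝ) :
    specProj A Sᶜ = 1 - specProj A S := by
  have key : (spectralSpan A Sᶜ).topologicalClosure = (spectralSpan A S).topologicalClosureᗮ := by
    rw [Submodule.orthogonal_closure]
    apply le_antisymm
    · exact Submodule.topologicalClosure_minimal _ (spectralSpan_le_orthogonal_compl hA S)
        (Submodule.isClosed_orthogonal _)
    · intro v hv
      set K := (spectralSpan A Sᶜ).topologicalClosure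
      have h1 : v - K.starProjection v ∈ Kᗮ := Submodule.sub_starProjection_mem_orthogonal v
      have h2 : K.starProjection v ∈ (spectralSpan A S)ᗮ :=
        Submodule.topologicalClosure_minimal _ (spectralSpan_le_orthogonal_compl hA S)
          (Submodule.isClosed_orthogonal _) (Submodule.starProjection_apply_mem K v)
      have h3 : v - K.starProjection v ∈ (spectralSpan A S)ᗮ ⊓ (spectralSpan A Sᶜ)ᗮ :=
        ⟨Submodule.sub_mem _ hv h2, Submodule.orthogonal_le (Submodule.le_topologicalClosure _) h1⟩
      rw [spectralSpan_orthogonal_inf_compl hc hA, Submodule.mem_bot, sub_eq_zero] at h3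
      rw [h3]
      exact Submodule.starProjection_apply_mem K v
  rw [specProj_eq, specProj_eq]
  simp only [key]
  exact Submodule.starProjection_orthogonal' _

theorem inner_specProj_left (A : H →L[ℂ] H) (S : Set ℝ) (u v : H) :
    ⟪specProj A S u, v⟫_ℂ = ⟪u, specProj A S v⟫_ℂ :=
  Submodule.inner_starProjection_left_eq_right _ u v

theorem specProj_specProj (A : H →L[ℂ] H) (S : Set ℝ) (v : H) :
    specProj A S (specProj A S v) = specProj A S v :=
  Submodule.starProjection_eq_self_iff.2 (specProj_apply_mem A S v)

theorem inner_specProj_self (A : H →L[ℂ] H) (S : Set ℝ) (v : H) :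
    ⟪v, specProj A S v⟫_ℂ = (‖specProj A S v‖ : ℂ) ^ 2 := by
  rw [← specProj_specProj, ← inner_specProj_left, inner_self_eq_norm_sq_to_K, specProj_specProj]
  rfl

theorem norm_specProj_le (A : H →L[ℂ] H) (S : Set ℝ) (v : H) : ‖specProj A S v‖ ≤ ‖v‖ :=
  Submodule.norm_starProjection_apply_le _ v

theorem norm_sub_specProj_sq (A : H →L[ℂ] H) (S : Set ℝ) (v : H) :
    ‖v - specProj A S v‖ ^ 2 = ‖v‖ ^ 2 - ‖specProj A S v‖ ^ 2 := by
  have h := congrArg Complex.re (inner_specProj_self A S v)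
  rw [@norm_sub_sq ℂ]
  have h2 : RCLike.re ⟪v, specProj A S v⟫_ℂ = ‖specProj A S v‖ ^ 2 := by
    rw [inner_specProj_self]
    norm_cast
  rw [h2]; ring

/-- The range of the projection is invariant under `A`, hence by symmetry so is its orthogonal
complement. -/
theorem specProj_comm (hA : (A : H →ₗ[ℂ] H).IsSymmetric) (S : Set ℝ) (v : H) :
    A (specProj A S v) = specProj A S (A v) := by
  have h1 : specProj A S (A (specProj A S v)) = A (specProj A S v) :=
    Submodule.starProjection_eq_self_iff.2
      (apply_mem_closure_spectralSpan A (specProj_apply_mem A S v))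
  have h2 : specProj A S (A (v - specProj A S v)) = 0 := by
    refine (Submodule.starProjection_apply_eq_zero_iff _).2 ?_
    rw [Submodule.mem_orthogonal]
    intro u hu
    have h3 := hA u (v - specProj A S v)
    simp only [ContinuousLinearMap.coe_coe] at h3
    rw [← h3]
    exact (Submodule.sub_starProjection_mem_orthogonal v) _
      (apply_mem_closure_spectralSpan A hu)
  rw [map_sub, map_sub, sub_eq_zero, h1] at h2
  exact h2.symm

theorem specProj_apply_of_eigen {S : Set ℝ} {x : ℝ} (hx : x ∈ S) {v : H}
    (hv : A v = (x : ℂ) • v) : specProj A S v = v := by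
  refine Submodule.starProjection_eq_self_iff.2 (Submodule.le_topologicalClosure _
    (eigenspace_le_spectralSpan A hx ?_))
  rw [Module.End.mem_eigenspace_iff]
  exact hv

theorem specProj_apply_of_eigen_notMem (hA : (A : H →ₗ[ℂ] H).IsSymmetric) {S : Set ℝ} {x : ℝ}
    (hx : x ∉ S) {v : H} (hv : A v = (x : ℂ) • v) : specProj A S v = 0 := by
  refine (Submodule.starProjection_apply_eq_zero_iff _).2 ?_
  rw [Submodule.orthogonal_closure]
  refine spectralSpan_le_orthogonal_compl hA S (eigenspace_le_spectralSpan A (S := Sᶜ) hx ?_)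
  rw [Module.End.mem_eigenspace_iff]
  exact hv

end Spectral

/-! ### Traces against pure states. -/

section Trace

variable {H : Type*} [NormedAddCommGroup H] [InnerProductSpace ℂ H]

theorem IsPureState.norm_eq_one {ρ : H →L[ℂ] H} (hρ : IsPureState ρ) : ‖ρ‖ = 1 := by
  obtain ⟨ψ, h, rfl⟩ := hρ
  simp [h]

theorem IsPureState.isCompactOperator {ρ : H →L[ℂ] H} (hρ : IsPureState ρ) :
    IsCompactOperator ρ := by
  obtain ⟨ψ, -, rfl⟩ := hρ
  rw [InnerProductSpace.rankOne_def']
  exact (isCompactOperator_of_locallyCompactSpace_rng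
    (ContinuousLinearMap.toSpanSingleton ℂ ψ)).comp_clm (innerSL ℂ ψ)

variable [CompleteSpace H]

/-- Parseval's identity for `T* ψ` and `ψ`; from here on the chosen basis plays no role for pure
states. -/
theorem trace_rankOne_mul (ψ : H) (T : H →L[ℂ] H) :
    trace (InnerProductSpace.rankOne ℂ ψ ψ * T) = ⟪ψ, T ψ⟫_ℂ := by
  have h := ((exists_hilbertBasis ℂ H).choose_spec.choose).hasSum_inner_mul_inner
    (ContinuousLinearMap.adjoint T ψ) ψ
  rw [ContinuousLinearMap.adjoint_inner_left] at h
  rw [← h.tsum_eq, trace]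
  refine tsum_congr fun i => ?_
  rw [mul_apply_eq_comp, InnerProductSpace.rankOne_apply, inner_smul_right,
    ContinuousLinearMap.adjoint_inner_left]

theorem prob_rankOne (ψ : H) (T : H →L[ℂ] H) :
    prob (InnerProductSpace.rankOne ℂ ψ ψ) T = (⟪ψ, T ψ⟫_ℂ).re := by
  rw [prob, trace_rankOne_mul]

theorem trace_eq_prob_of_isPositive {ρ T : H →L[ℂ] H} (hρ : IsPureState ρ) (hT : T.IsPositive) :
    trace (ρ * T) = (prob ρ T : ℂ) := by
  obtain ⟨ψ, -, rfl⟩ := hρ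
  rw [trace_rankOne_mul, prob_rankOne]
  have h := hT.isSymmetric ψ ψ
  simp only [ContinuousLinearMap.coe_coe] at h
  refine (Complex.conj_eq_iff_re.1 ?_).symm
  rw [inner_conj_symm, h]

theorem mul_mul_eq_of_isPureState {ρ T : H →L[ℂ] H} (hρ : IsPureState ρ) :
    ρ * T * ρ = trace (ρ * T) • ρ := by
  obtain ⟨ψ, -, rfl⟩ := hρ
  rw [trace_rankOne_mul]
  ext v
  simp [smul_smul, mul_comm]

theorem prob_nonneg_of_isPureState {ρ T : H →L[ℂ] H} (hρ : IsPureState ρ) (hT : T.IsPositive) :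
    0 ≤ prob ρ T := by
  obtain ⟨ψ, h, rfl⟩ := hρ
  rw [prob_rankOne]
  exact hT.re_inner_nonneg_right ψ

/-- For pure states the probability of an effect is a norm, hence measurable in both arguments. -/
theorem prob_eq_norm_of_isPureState {ρ T : H →L[ℂ] H} (hρ : IsPureState ρ) (hT : T.IsPositive) :
    prob ρ T = ‖ρ * T * ρ‖ := by
  rw [mul_mul_eq_of_isPureState hρ, norm_smul, hρ.norm_eq_one, mul_one,
    trace_eq_prob_of_isPositive hρ hT, Complex.norm_real, Real.norm_eq_abs,
    abs_of_nonneg (prob_nonneg_of_isPureState hρ hT)]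

theorem isPositive_specProj (A : H →L[ℂ] H) (S : Set ℝ) : (specProj A S).IsPositive :=
  ContinuousLinearMap.IsPositive.of_isStarProjection (by
    rw [specProj_eq]; exact isStarProjection_starProjection)

end Trace

/-! ### The averaged output state. -/

section Average

variable {X : Type*} [MeasurableSpace X] {H : Type*} [NormedAddCommGroup H]
  [InnerProductSpace ℂ H] [CompleteSpace H] (W : Channel X H)

theorem Channel.integrable_out (hW : ∀ x, IsPureState (W.out x)) (P : ProbabilityMeasure X) :
    Integrable W.out (P : Measure X) :=
  Integrable.of_bound W.stronglyMeasurable.aestronglyMeasurable 1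
    (ae_of_all _ fun x => (hW x).norm_eq_one.le)

theorem Channel.stronglyMeasurable_prob (hW : ∀ x, IsPureState (W.out x)) {T : H →L[ℂ] H}
    (hT : T.IsPositive) : StronglyMeasurable fun x => prob (W.out x) T := by
  simp_rw [fun x => prob_eq_norm_of_isPureState (hW x) hT]
  exact ((W.stronglyMeasurable.mul stronglyMeasurable_const).mul W.stronglyMeasurable).norm

theorem inner_avg (hW : ∀ x, IsPureState (W.out x)) (P : ProbabilityMeasure X) (u v : H) :
    ⟪u, W.avg P v⟫_ℂ = ∫ x, ⟪u, W.out x v⟫_ℂ ∂(P : Measure X) := by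
  have hi := W.integrable_out hW P
  rw [Channel.avg, ContinuousLinearMap.integral_apply hi, integral_inner]
  exact hi.apply_continuousLinearMap v

/-- `H` may be nonseparable, and exchanging sum and integral needs a countable sum. A strongly
measurable map has separable range; each state in a countable dense family is nonzero on only
countably many basis vectors, and vanishing at a vector is a closed condition. -/
theorem exists_countable_out_apply_eq_zero (hW : ∀ x, IsPureState (W.out x)) {ι : Type*}
    (e : HilbertBasis ι ℂ H) :
    ∃ S : Set ι, S.Countable ∧ ∀ i ∉ S, ∀ x, W.out x (e i) = 0 := by
  obtain ⟨t, ht, htc, hd⟩ :=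
    W.stronglyMeasurable.isSeparable_range.exists_countable_dense_subset
  refine ⟨⋃ A ∈ t, {i | A (e i) ≠ 0}, htc.biUnion fun A hA => ?_, fun i hi x => ?_⟩
  · obtain ⟨x, rfl⟩ := ht hA
    obtain ⟨ψ, -, hψ⟩ := hW x
    refine (e.orthonormal.inner_products_summable ψ).countable_support.mono fun i hi => ?_
    simp only [Set.mem_ofPred_eq, hψ, InnerProductSpace.rankOne_apply, ne_eq, smul_eq_zero,
      not_or] at hi
    simp only [Function.mem_support, ne_eq, pow_eq_zero_iff two_ne_zero, norm_eq_zero]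
    rw [inner_eq_zero_symm]
    exact hi.1
  · have hc : IsClosed {A : H →L[ℂ] H | A (e i) = 0} :=
      isClosed_eq (by fun_prop) continuous_const
    refine closure_minimal (fun A hA => ?_) hc (hd ⟨x, rfl⟩)
    by_contra h
    exact hi (Set.mem_biUnion hA h)

/-- Each term is a product of coefficients of `ψ` and `T* ψ`, so the arithmetic-geometric mean
inequality and Bessel apply. The bound is uniform in `ψ`, as needed to integrate the trace series
termwise. -/
theorem tsum_enorm_inner_rankOne_le {ι : Type*} {e : ι → H} (he : Orthonormal ℂ e) {ψ : H}
    (hψ : ‖ψ‖ = 1) (T : H →L[ℂ] H) :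
    ∑' i, ‖⟪e i, (InnerProductSpace.rankOne ℂ ψ ψ) (T (e i))⟫_ℂ‖ₑ
      ≤ ENNReal.ofReal ((‖T‖ ^ 2 + 1) / 2) := by
  set φ := ContinuousLinearMap.adjoint T ψ with hφ
  have hφn : ‖φ‖ ≤ ‖T‖ := by
    have h := (ContinuousLinearMap.adjoint T).le_opNorm ψ
    rwa [hψ, mul_one, LinearIsometryEquiv.norm_map] at h
  have hb : ∀ i, ‖⟪e i, (InnerProductSpace.rankOne ℂ ψ ψ) (T (e i))⟫_ℂ‖
      ≤ (‖⟪e i, φ⟫_ℂ‖ ^ 2 + ‖⟪e i, ψ⟫_ℂ‖ ^ 2) / 2 := by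
    intro i
    rw [InnerProductSpace.rankOne_apply, inner_smul_right, norm_mul,
      ← ContinuousLinearMap.adjoint_inner_left, norm_inner_symm, ← hφ]
    nlinarith [sq_nonneg (‖⟪e i, φ⟫_ℂ‖ - ‖⟪e i, ψ⟫_ℂ‖)]
  have hs : Summable fun i => (‖⟪e i, φ⟫_ℂ‖ ^ 2 + ‖⟪e i, ψ⟫_ℂ‖ ^ 2) / 2 :=
    ((he.inner_products_summable φ).add (he.inner_products_summable ψ)).div_const 2
  calc ∑' i, ‖⟪e i, (InnerProductSpace.rankOne ℂ ψ ψ) (T (e i))⟫_ℂ‖ₑ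
      ≤ ∑' i, ENNReal.ofReal ((‖⟪e i, φ⟫_ℂ‖ ^ 2 + ‖⟪e i, ψ⟫_ℂ‖ ^ 2) / 2) := by
        refine ENNReal.tsum_le_tsum fun i => ?_
        rw [← ofReal_norm]
        exact ENNReal.ofReal_le_ofReal (hb i)
    _ = ENNReal.ofReal (∑' i, (‖⟪e i, φ⟫_ℂ‖ ^ 2 + ‖⟪e i, ψ⟫_ℂ‖ ^ 2) / 2) :=
        (ENNReal.ofReal_tsum_of_nonneg (fun i => by positivity) hs).symm
    _ ≤ _ := by
        refine ENNReal.ofReal_le_ofReal ?_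
        rw [tsum_div_const, (he.inner_products_summable φ).tsum_add (he.inner_products_summable ψ)]
        have h1 := he.tsum_inner_products_le φ
        have h2 := he.tsum_inner_products_le ψ
        rw [hψ] at h2
        have h3 : ‖φ‖ ^ 2 ≤ ‖T‖ ^ 2 := pow_le_pow_left₀ (norm_nonneg _) hφn 2
        linarith

/-- The probability of an effect in the averaged output of a pure channel is the average of the
probabilities. -/
theorem prob_avg (hW : ∀ x, IsPureState (W.out x)) (P : ProbabilityMeasure X) {T : H →L[ℂ] H}
    (hT : T.IsPositive) :
    prob (W.avg P) T = ∫ x, prob (W.out x) T ∂(P : Measure X) := by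
  set e := (exists_hilbertBasis ℂ H).choose_spec.choose with he
  obtain ⟨S, hSc, hS⟩ := exists_countable_out_apply_eq_zero W hW e
  have hS' : ∀ i ∉ S, ∀ x v, ⟪e i, W.out x v⟫_ℂ = 0 := by
    intro i hi x v
    have h := (W.isDensityOperator x).1.isSymmetric (e i) v
    simp only [ContinuousLinearMap.coe_coe] at h
    rw [← h, hS i hi x, inner_zero_left]
  have : Countable S := hSc.to_subtype
  have h1 : ∀ x, ∑' i : S, ⟪e i, W.out x (T (e i))⟫_ℂ = (prob (W.out x) T : ℂ) := by
    intro x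
    rw [← trace_eq_prob_of_isPositive (hW x) hT, trace]
    exact tsum_subtype_eq_of_support_subset (f := fun i => ⟪e i, W.out x (T (e i))⟫_ℂ)
      fun i hi => by_contra fun h => hi (hS' i h x _)
  have h2 : trace (W.avg P * T) = ∑' i : S, ∫ x, ⟪e i, W.out x (T (e i))⟫_ℂ ∂(P : Measure X) := by
    simp_rw [← inner_avg W hW P]
    refine (tsum_subtype_eq_of_support_subset (f := fun i => ⟪e i, W.avg P (T (e i))⟫_ℂ)
      fun i hi => by_contra fun h => hi ?_).symm
    simp [inner_avg W hW P, hS' i h]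
  have h3 : trace (W.avg P * T) = ((∫ x, prob (W.out x) T ∂(P : Measure X) : ℝ) : ℂ) := by
    rw [h2, ← integral_complex_ofReal, ← integral_tsum]
    · simp_rw [h1]
    · intro i
      exact (stronglyMeasurable_const.inner
        ((ContinuousLinearMap.apply ℂ H _).continuous.comp_stronglyMeasurable W.stronglyMeasurable)).aestronglyMeasurable
    · rw [← lintegral_tsum]
      · refine ne_of_lt (lt_of_le_of_lt (lintegral_mono (g := fun _ =>
          ENNReal.ofReal ((‖T‖ ^ 2 + 1) / 2)) fun x => ?_) ?_)
        · obtain ⟨ψ, hψ, h⟩ := hW x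
          rw [h]
          exact tsum_enorm_inner_rankOne_le (e.orthonormal.comp _ Subtype.coe_injective) hψ T
        · simp
      · intro i
        exact (stronglyMeasurable_const.inner
          ((ContinuousLinearMap.apply ℂ H _).continuous.comp_stronglyMeasurable W.stronglyMeasurable)).enorm.aemeasurable
  rw [prob, h3, Complex.ofReal_re]

theorem integrable_prob (hW : ∀ x, IsPureState (W.out x)) (P : ProbabilityMeasure X)
    {T : H →L[ℂ] H} (hT : T.IsPositive) :
    Integrable (fun x => prob (W.out x) T) (P : Measure X) := by
  refine Integrable.of_bound (W.stronglyMeasurable_prob hW hT).aestronglyMeasurable ‖T‖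
    (ae_of_all _ fun x => ?_)
  rw [prob_eq_norm_of_isPureState (hW x) hT, norm_norm]
  refine (norm_mul_le _ _).trans ?_
  rw [(hW x).norm_eq_one, mul_one]
  refine (norm_mul_le _ _).trans ?_
  rw [(hW x).norm_eq_one, one_mul]

theorem avg_isSymmetric (hW : ∀ x, IsPureState (W.out x)) (P : ProbabilityMeasure X) :
    (W.avg P : H →ₗ[ℂ] H).IsSymmetric := by
  intro u v
  simp only [ContinuousLinearMap.coe_coe]
  rw [← inner_conj_symm, inner_avg W hW P, inner_avg W hW P, ← integral_conj]
  refine integral_congr_ae (ae_of_all _ fun x => ?_)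
  have h := (W.isDensityOperator x).1.isSymmetric u v
  simp only [ContinuousLinearMap.coe_coe] at h
  simp only [inner_conj_symm, h]

theorem re_inner_avg_self (hW : ∀ x, IsPureState (W.out x)) (P : ProbabilityMeasure X) (v : H) :
    (⟪v, W.avg P v⟫_ℂ).re = ∫ x, (⟪v, W.out x v⟫_ℂ).re ∂(P : Measure X) := by
  rw [inner_avg W hW P]
  exact (integral_re (𝕜 := ℂ) (((W.integrable_out hW P).apply_continuousLinearMap v).const_inner (𝕜 := ℂ) v)).symm

theorem re_inner_avg_self_nonneg (hW : ∀ x, IsPureState (W.out x)) (P : ProbabilityMeasure X)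
    (v : H) : 0 ≤ (⟪v, W.avg P v⟫_ℂ).re := by
  rw [re_inner_avg_self W hW P]
  exact integral_nonneg fun x => (W.isDensityOperator x).1.re_inner_nonneg_right v

/-- The compact operators form a closed convex set, which contains the mean of any integrable map
into it. -/
theorem avg_isCompactOperator (hW : ∀ x, IsPureState (W.out x)) (P : ProbabilityMeasure X) :
    IsCompactOperator (W.avg P) := by
  have hcl : IsClosed (compactOperator (RingHom.id ℂ) H H : Set (H →L[ℂ] H)) :=
    isClosed_setOfPred_isCompactOperator
  exact ((compactOperator (RingHom.id ℂ) H H).restrictScalars ℝ).convex.integral_mem hcl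
    (ae_of_all _ fun x => (hW x).isCompactOperator) (W.integrable_out hW P)

end Average

/-! ### Comparison of the two tests on a single pure state. -/

section Pointwise

variable {H : Type*} [NormedAddCommGroup H] [InnerProductSpace ℂ H]

theorem re_inner_rankOne_self (ψ v : H) :
    (⟪v, InnerProductSpace.rankOne ℂ ψ ψ v⟫_ℂ).re = ‖⟪ψ, v⟫_ℂ‖ ^ 2 := by
  rw [InnerProductSpace.rankOne_apply, inner_smul_right, ← inner_conj_symm v ψ, Complex.mul_conj,
    Complex.ofReal_re, Complex.normSq_eq_norm_sq]

theorem re_inner_rankOne_sub_smul (ψ : H) (ρ : H →L[ℂ] H) (c : ℝ) (v : H) :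
    (⟪v, (InnerProductSpace.rankOne ℂ ψ ψ - (c : ℂ) • ρ) v⟫_ℂ).re =
      ‖⟪ψ, v⟫_ℂ‖ ^ 2 - c * (⟪v, ρ v⟫_ℂ).re := by
  rw [← re_inner_rankOne_self, sub_apply, inner_sub_right, smul_apply, inner_smul_right,
    Complex.sub_re, Complex.re_ofReal_mul]

theorem isSymmetric_sub_smul {A B : H →L[ℂ] H} (hA : (A : H →ₗ[ℂ] H).IsSymmetric)
    (hB : (B : H →ₗ[ℂ] H).IsSymmetric) (c : ℝ) :
    ((A - (c : ℂ) • B : H →L[ℂ] H) : H →ₗ[ℂ] H).IsSymmetric := by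
  intro u v
  have h1 := hA u v
  have h2 := hB u v
  simp only [ContinuousLinearMap.coe_coe] at h1 h2
  simp only [ContinuousLinearMap.coe_coe, sub_apply, smul_apply, inner_sub_left, inner_sub_right,
    inner_smul_left, inner_smul_right, Complex.conj_ofReal, h1, h2]

theorem isCompactOperator_sub_smul {A B : H →L[ℂ] H} (hA : IsCompactOperator A)
    (hB : IsCompactOperator B) (c : ℂ) : IsCompactOperator (A - c • B : H →L[ℂ] H) :=
  hA.sub (hB.smul c)

variable [CompleteSpace H]

theorem re_inner_apply_eq_add {A : H →L[ℂ] H} (hA : (A : H →ₗ[ℂ] H).IsSymmetric) (S : Set ℝ)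
    (v : H) :
    (⟪v, A v⟫_ℂ).re = (⟪specProj A S v, A (specProj A S v)⟫_ℂ).re +
      (⟪v - specProj A S v, A (v - specProj A S v)⟫_ℂ).re := by
  have h1 : ⟪specProj A S v, A v⟫_ℂ = ⟪specProj A S v, A (specProj A S v)⟫_ℂ := by
    rw [specProj_comm hA, ← inner_specProj_left, specProj_specProj]
  have h2 : ⟪v, A (specProj A S v)⟫_ℂ = ⟪specProj A S v, A (specProj A S v)⟫_ℂ := by
    rw [specProj_comm hA, ← inner_specProj_left, h1, specProj_comm hA, ← inner_specProj_left,
      specProj_specProj, h1]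
  rw [map_sub, inner_sub_left, inner_sub_right, inner_sub_right, h1, h2]
  simp

theorem prob_rankOne_specProj (ψ : H) (A : H →L[ℂ] H) (S : Set ℝ) :
    prob (InnerProductSpace.rankOne ℂ ψ ψ) (specProj A S) = ‖specProj A S ψ‖ ^ 2 := by
  rw [prob_rankOne, inner_specProj_self]
  norm_cast

theorem specProj_Ioi_eq {A : H →L[ℂ] H} (hc : IsCompactOperator A)
    (hA : (A : H →ₗ[ℂ] H).IsSymmetric) (t : ℝ) :
    specProj A (Set.Ioi t) = 1 - specProj A (Set.Iic t) := by
  rw [← specProj_compl hc hA, Set.compl_Iic]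

theorem specProj_Iio_eq {A : H →L[ℂ] H} (hc : IsCompactOperator A)
    (hA : (A : H →ₗ[ℂ] H).IsSymmetric) (t : ℝ) :
    specProj A (Set.Iio t) = 1 - specProj A (Set.Ici t) := by
  rw [← specProj_compl hc hA, Set.compl_Ici]

variable {ψ : H} {ρ : H →L[ℂ] H}

/-- Evaluate `A = |ψ⟩⟨ψ| - cρ` at `v = {ρ < t} ψ`. From below, `⟪v, A v⟫ ≥ ‖v‖² (‖v‖² - c t)`. From
above, only the positive part of `A` counts, and it contributes at most `|⟪ψ, v - Q v⟫|² ≤ ‖ψ - Q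
ψ‖² ‖v‖²`. Divide by `‖v‖²`. -/
theorem prob_specProj_sub_smul_le (hψ : ‖ψ‖ = 1) (hc : IsCompactOperator ρ)
    (hs : (ρ : H →ₗ[ℂ] H).IsSymmetric) (hp : ∀ v, 0 ≤ (⟪v, ρ v⟫_ℂ).re) {c t : ℝ} (hc0 : 0 ≤ c)
    (ht : 0 ≤ t) :
    prob (InnerProductSpace.rankOne ℂ ψ ψ)
        (specProj (InnerProductSpace.rankOne ℂ ψ ψ - (c : ℂ) • ρ) (Set.Iic 0)) ≤
      prob (InnerProductSpace.rankOne ℂ ψ ψ) (specProj ρ (Set.Ici t)) + c * t := by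
  set A := InnerProductSpace.rankOne ℂ ψ ψ - (c : ℂ) • ρ with hAdef
  have hWs : (InnerProductSpace.rankOne ℂ ψ ψ : H →ₗ[ℂ] H).IsSymmetric :=
    (InnerProductSpace.isPositive_rankOne_self ψ).isSymmetric
  have hAs : (A : H →ₗ[ℂ] H).IsSymmetric := isSymmetric_sub_smul hWs hs c
  have hAf := re_inner_rankOne_sub_smul ψ ρ c
  rw [← hAdef] at hAf
  rw [prob_rankOne_specProj, prob_rankOne_specProj]
  have hAQ := specProj_Ioi_eq (isCompactOperator_sub_smul
    (IsPureState.isCompactOperator ⟨ψ, hψ, rfl⟩) hc (c : ℂ)) hAs 0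
  set Q := specProj A (Set.Iic 0) with hQ
  set E := specProj ρ (Set.Ici t) with hE
  set v := ψ - E ψ with hv
  have hq : ‖v‖ ^ 2 = 1 - ‖E ψ‖ ^ 2 := by
    rw [hv, hE, norm_sub_specProj_sq, hψ]; norm_num
  have hpp : ‖ψ - Q ψ‖ ^ 2 = 1 - ‖Q ψ‖ ^ 2 := by
    rw [hQ, norm_sub_specProj_sq, hψ]; norm_num
  have hψv : ⟪ψ, v⟫_ℂ = (‖v‖ : ℂ) ^ 2 := by
    have h : (‖v‖ : ℂ) ^ 2 = ((1 - ‖E ψ‖ ^ 2 : ℝ) : ℂ) := by rw [← hq]; norm_cast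
    rw [h, hv, inner_sub_right, hE, inner_specProj_self, inner_self_eq_norm_sq_to_K, hψ]
    push_cast
    norm_num
  have h1 : (⟪v, ρ v⟫_ℂ).re ≤ t * ‖v‖ ^ 2 := by
    have h : specProj ρ (Set.Iio t) ψ = v := by rw [specProj_Iio_eq hc hs]; rfl
    have := re_inner_specProj_le hs (S := Set.Iio t) (t := t) (fun x hx => le_of_lt hx) ψ
    rwa [h] at this
  have h2 := re_inner_apply_eq_add hAs (Set.Iic 0) v
  have h3 := re_inner_specProj_le hAs (S := Set.Iic 0) (t := 0) (fun x hx => hx) v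
  rw [hAf v, hψv, hAf (v - _)] at h2
  have h4 : ‖⟪ψ, v - Q v⟫_ℂ‖ ^ 2 ≤ (1 - ‖Q ψ‖ ^ 2) * ‖v‖ ^ 2 := by
    have : ⟪ψ, v - Q v⟫_ℂ = ⟪ψ - Q ψ, v⟫_ℂ := by
      rw [inner_sub_right, inner_sub_left, inner_specProj_left]
    rw [this, ← hpp, ← mul_pow]
    exact pow_le_pow_left₀ (norm_nonneg _) (norm_inner_le_norm _ _) 2
  have h5 := mul_nonneg hc0 (hp (v - Q v))
  have h6 : ‖((‖v‖ : ℂ)) ^ 2‖ = ‖v‖ ^ 2 := by simp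
  rw [h6] at h2
  have h7 := mul_le_mul_of_nonneg_left h1 hc0
  have h8 : (‖v‖ ^ 2) * (‖v‖ ^ 2 - c * t) ≤ (‖v‖ ^ 2) * (1 - ‖Q ψ‖ ^ 2) := by nlinarith
  have hm : 0 ≤ c * t := mul_nonneg hc0 ht
  rcases (sq_nonneg ‖v‖).eq_or_lt with h9 | h9
  · have h10 : 0 ≤ ‖ψ - Q ψ‖ ^ 2 := sq_nonneg _
    linarith
  · have := le_of_mul_le_mul_left h8 h9
    linarith

/-- Take `v = {A > 0} ψ`. Since `⟪v, A v⟫ ≥ 0`, one gets `c t ‖E v‖² ≤ ‖v‖⁴`, so `v` has only a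
small part `‖E v‖ ≤ s ‖v‖²` in the range of `E`. Splitting `⟪ψ, v⟫ = ‖v‖²` along `E` yields `(1 - s)
‖v‖ ≤ ‖ψ - E ψ‖`, and squaring gives the claim. -/
theorem prob_specProj_le (hψ : ‖ψ‖ = 1) (hc : IsCompactOperator ρ)
    (hs : (ρ : H →ₗ[ℂ] H).IsSymmetric) (hp : ∀ v, 0 ≤ (⟪v, ρ v⟫_ℂ).re) {c t s : ℝ} (hc0 : 0 ≤ c)
    (hs0 : 0 ≤ s) (hcts : 1 ≤ c * t * s ^ 2) :
    prob (InnerProductSpace.rankOne ℂ ψ ψ) (specProj ρ (Set.Ici t)) ≤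
      prob (InnerProductSpace.rankOne ℂ ψ ψ)
        (specProj (InnerProductSpace.rankOne ℂ ψ ψ - (c : ℂ) • ρ) (Set.Iic 0)) + 2 * s := by
  set A := InnerProductSpace.rankOne ℂ ψ ψ - (c : ℂ) • ρ with hAdef
  have hWs : (InnerProductSpace.rankOne ℂ ψ ψ : H →ₗ[ℂ] H).IsSymmetric :=
    (InnerProductSpace.isPositive_rankOne_self ψ).isSymmetric
  have hAs : (A : H →ₗ[ℂ] H).IsSymmetric := isSymmetric_sub_smul hWs hs c
  have hAf := re_inner_rankOne_sub_smul ψ ρ c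
  rw [← hAdef] at hAf
  rw [prob_rankOne_specProj, prob_rankOne_specProj]
  have hAQ := specProj_Ioi_eq (isCompactOperator_sub_smul
    (IsPureState.isCompactOperator ⟨ψ, hψ, rfl⟩) hc (c : ℂ)) hAs 0
  set Q := specProj A (Set.Iic 0) with hQ
  set E := specProj ρ (Set.Ici t) with hE
  set v := ψ - Q ψ with hv
  have hvP : specProj A (Set.Ioi 0) ψ = v := by rw [hAQ]; rfl
  have hq : ‖v‖ ^ 2 = 1 - ‖Q ψ‖ ^ 2 := by
    rw [hv, hQ, norm_sub_specProj_sq, hψ]; norm_num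
  have hm : ‖ψ - E ψ‖ ^ 2 = 1 - ‖E ψ‖ ^ 2 := by
    rw [hE, norm_sub_specProj_sq, hψ]; norm_num
  have hψv : ⟪ψ, v⟫_ℂ = (‖v‖ : ℂ) ^ 2 := by
    rw [← hvP, inner_specProj_self]
  have h1 := le_re_inner_specProj hAs (S := Set.Ioi 0) (t := 0) (fun x hx => le_of_lt hx) ψ
  rw [hvP, hAf, hψv] at h1
  have h2 := re_inner_apply_eq_add hs (Set.Ici t) v
  have h3 := le_re_inner_specProj hs (S := Set.Ici t) (t := t) (fun x hx => hx) v
  have h4 := hp (v - specProj ρ (Set.Ici t) v)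
  have h6 : ‖((‖v‖ : ℂ)) ^ 2‖ = ‖v‖ ^ 2 := by simp
  rw [h6] at h1
  have h5 : c * t * ‖E v‖ ^ 2 ≤ (‖v‖ ^ 2) ^ 2 := by
    have : c * (t * ‖E v‖ ^ 2) ≤ c * (⟪v, ρ v⟫_ℂ).re :=
      mul_le_mul_of_nonneg_left (by linarith) hc0
    nlinarith
  have h7 : ‖E v‖ ≤ s * ‖v‖ ^ 2 := by
    refine abs_le_of_sq_le_sq' ?_ (by positivity) |>.2
    have := mul_le_mul_of_nonneg_left h5 (sq_nonneg s)
    have h8 := mul_le_mul_of_nonneg_right hcts (sq_nonneg ‖E v‖)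
    nlinarith
  have h8 : ‖v‖ ^ 2 ≤ ‖E ψ‖ * ‖E v‖ + ‖ψ - E ψ‖ * ‖v‖ := by
    have : ⟪ψ, v⟫_ℂ = ⟪E ψ, E v⟫_ℂ + ⟪ψ - E ψ, v⟫_ℂ := by
      rw [inner_sub_left, hE, inner_specProj_left, inner_specProj_left, specProj_specProj]
      ring
    have h9 := norm_add_le (⟪E ψ, E v⟫_ℂ) (⟪ψ - E ψ, v⟫_ℂ)
    rw [← this, hψv, h6] at h9
    exact h9.trans (add_le_add (norm_inner_le_norm _ _) (norm_inner_le_norm _ _))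
  have hE1 : ‖E ψ‖ ≤ 1 := hψ ▸ norm_specProj_le ρ _ ψ
  -- For `s ≥ 1` the right side already exceeds `1`; otherwise `1 - s` is positive and the
  -- inequality may be squared.
  rcases le_or_gt 1 s with hs1 | hs1
  · nlinarith [sq_nonneg ‖Q ψ‖, norm_nonneg (E ψ)]
  have h10 : ‖E ψ‖ * ‖E v‖ ≤ s * ‖v‖ ^ 2 := by
    nlinarith [norm_nonneg (E v), norm_nonneg (E ψ)]
  have h11 : ‖v‖ * ((1 - s) * ‖v‖) ≤ ‖v‖ * ‖ψ - E ψ‖ := by nlinarith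
  have hE0 : ‖E ψ‖ ^ 2 ≤ 1 := pow_le_one₀ (norm_nonneg _) hE1
  rcases (norm_nonneg v).eq_or_lt with h9 | h9
  · rw [← h9] at hq
    nlinarith
  · have h12 := le_of_mul_le_mul_left h11 h9
    have h13 : ((1 - s) * ‖v‖) ^ 2 ≤ ‖ψ - E ψ‖ ^ 2 :=
      pow_le_pow_left₀ (mul_nonneg (by linarith) (norm_nonneg _)) h12 2
    have hv1 : ‖v‖ ^ 2 ≤ 1 := by rw [hq]; nlinarith [sq_nonneg ‖Q ψ‖]
    nlinarith [mul_nonneg hs0 (sub_nonneg.2 hv1), mul_nonneg (sq_nonneg s) (sq_nonneg ‖v‖)]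

end Pointwise

/-! ### Spectral projections as strong limits of polynomials. -/

section PolynomialApproximation

/-- Polynomials approximating the indicator function of the positive half-line on `[-R, R]`. -/
theorem exists_polynomial_tendsto_indicator (R : ℝ) :
    ∃ q : ℕ → Polynomial ℝ, (∀ n, ∀ y ∈ Set.Icc (-R) R, |(q n).eval y| ≤ 2) ∧
      (∀ y ∈ Set.Icc (-R) R, y ≤ 0 → Tendsto (fun n => (q n).eval y) atTop (𝓝 0)) ∧
      (∀ y ∈ Set.Icc (-R) R, 0 < y → Tendsto (fun n => (q n).eval y) atTop (𝓝 1)) := by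
  -- The clamped ramps `max 0 (min 1 (n y))` converge pointwise to the indicator of `y > 0`;
  -- Weierstrass replaces them by polynomials.
  have h : ∀ n : ℕ, ∃ p : Polynomial ℝ, ∀ y ∈ Set.Icc (-R) R,
      |p.eval y - max 0 (min 1 (n * y))| < 1 / ((n : ℝ) + 1) := fun n =>
    exists_polynomial_near_of_continuousOn (-R) R _ (by fun_prop) _ Nat.one_div_pos_of_nat
  choose q hq using h
  have hlim : ∀ y ∈ Set.Icc (-R) R, Tendsto (fun n : ℕ => (q n).eval y - max 0 (min 1 (n * y)))
      atTop (𝓝 0) := fun y hy =>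
    squeeze_zero_norm (fun n => (hq n y hy).le) tendsto_one_div_add_atTop_nhds_zero_nat
  refine ⟨q, fun n y hy => ?_, fun y hy hy0 => ?_, fun y hy hy0 => ?_⟩
  · have h1 := hq n y hy
    have h2 : 1 / ((n : ℝ) + 1) ≤ 1 := by
      rw [div_le_one (by positivity)]
      linarith [Nat.cast_nonneg (α := ℝ) n]
    have h3 : |max 0 (min 1 ((n : ℝ) * y))| ≤ 1 := by
      rw [abs_of_nonneg (le_max_left _ _)]
      exact max_le zero_le_one (min_le_left _ _)
    calc |(q n).eval y| = |((q n).eval y - max 0 (min 1 (n * y))) + max 0 (min 1 (n * y))| := by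
          rw [sub_add_cancel]
      _ ≤ _ := abs_add_le _ _
      _ ≤ 2 := by linarith
  · refine (hlim y hy).congr fun n => ?_
    have : (n : ℝ) * y ≤ 0 := mul_nonpos_of_nonneg_of_nonpos (Nat.cast_nonneg n) hy0
    rw [max_eq_left ((min_le_right _ _).trans this), sub_zero]
  · have h1 := (hlim y hy).add_const 1
    rw [zero_add] at h1
    refine h1.congr' ?_
    filter_upwards [(tendsto_natCast_atTop_atTop (R := ℝ)).eventually_ge_atTop (1 / y)] with n hn
    have : 1 ≤ (n : ℝ) * y := by rwa [div_le_iff₀ hy0] at hn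
    rw [min_eq_left this, max_eq_right zero_le_one, sub_add_cancel]

variable {H : Type*} [NormedAddCommGroup H] [InnerProductSpace ℂ H]

theorem aeval_apply_of_eigen {A : H →L[ℂ] H} {x : ℝ} {v : H} (hv : A v = (x : ℂ) • v)
    (q : Polynomial ℝ) : Polynomial.aeval A q v = ((q.eval x : ℝ) : ℂ) • v := by
  induction q using Polynomial.induction_on' with
  | add p q hp hq =>
    rw [map_add, add_apply, hp, hq, Polynomial.eval_add, Complex.ofReal_add, add_smul]
  | monomial n c =>
    rw [Polynomial.aeval_monomial, Polynomial.eval_monomial, mul_apply_eq_comp]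
    have h : (A ^ n) v = ((x ^ n : ℝ) : ℂ) • v := by
      induction n with
      | zero => simp
      | succ n ih =>
        rw [pow_succ, mul_apply_eq_comp, hv, map_smul, ih, smul_smul, pow_succ,
          Complex.ofReal_mul, mul_comm]
    rw [h, Algebra.algebraMap_eq_smul_one, smul_apply, one_apply_eq_self, Complex.ofReal_mul,
      mul_smul, Complex.coe_smul, Complex.coe_smul]

theorem tendsto_apply_of_mem_closure {T : ℕ → H →L[ℂ] H} {L : H →L[ℂ] H} {C : ℝ}
    (hT : ∀ n, ‖T n‖ ≤ C) {D : Submodule ℂ H}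
    (hD : ∀ v ∈ D, Tendsto (fun n => T n v) atTop (𝓝 (L v))) {v : H}
    (hv : v ∈ D.topologicalClosure) : Tendsto (fun n => T n v) atTop (𝓝 (L v)) := by
  have hC : 0 ≤ C := (norm_nonneg _).trans (hT 0)
  rw [Metric.tendsto_atTop]
  intro ε hε
  obtain ⟨w, hw, hvw⟩ := Metric.mem_closure_iff.1 hv (ε / (2 * (C + ‖L‖ + 1))) (by positivity)
  rw [dist_eq_norm, lt_div_iff₀ (by positivity)] at hvw
  obtain ⟨N, hN⟩ := Metric.tendsto_atTop.1 (hD w hw) (ε / 2) (half_pos hε)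
  refine ⟨N, fun n hn => ?_⟩
  have h1 := hN n hn
  rw [dist_eq_norm] at h1 ⊢
  have h2 : T n v - L v = T n (v - w) + (T n w - L w) - L (v - w) := by
    rw [map_sub, map_sub]; abel
  rw [h2]
  have h3 := (T n).le_of_opNorm_le (hT n) (v - w)
  have h4 := L.le_opNorm (v - w)
  have h5 := norm_sub_le (T n (v - w) + (T n w - L w)) (L (v - w))
  have h6 := norm_add_le (T n (v - w)) (T n w - L w)
  nlinarith [norm_nonneg (v - w)]

variable [CompleteSpace H]

theorem spectralSpan_univ_topologicalClosure {A : H →L[ℂ] H} (hc : IsCompactOperator A)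
    (hA : (A : H →ₗ[ℂ] H).IsSymmetric) : (spectralSpan A Set.univ).topologicalClosure = ⊤ := by
  rw [Submodule.topologicalClosure_eq_top_iff, eq_bot_iff,
    ← ContinuousLinearMap.orthogonalComplement_iSup_eigenspaces_eq_bot hc hA]
  exact Submodule.orthogonal_le (iSup_eigenspace_le_spectralSpan_univ hA)

theorem norm_aeval_le {A : H →L[ℂ] H} (hA : IsSelfAdjoint A) {R C : ℝ} (hR : ‖A‖ ≤ R)
    (hC : 0 ≤ C) {q : Polynomial ℝ} (hq : ∀ y ∈ Set.Icc (-R) R, |q.eval y| ≤ C) :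
    ‖Polynomial.aeval A q‖ ≤ C := by
  rw [← cfc_polynomial q A hA]
  refine norm_cfc_le hC fun x hx => hq x ?_
  -- On the zero space the spectrum is empty; bounding the spectrum by `‖A‖` requires `‖1‖ = 1`.
  rcases subsingleton_or_nontrivial H with h | h
  · exact absurd hx (by
      rw [spectrum.mem_iff, not_not]
      exact ⟨1, Subsingleton.elim _ _⟩)
  have := (spectrum.norm_le_norm_of_mem hx).trans hR
  exact Set.mem_Icc.2 (abs_le.1 this)

/-- Convergence is clear on eigenvectors. It extends to all of `H` because the eigenvectors are
total and the functional calculus bounds the polynomials uniformly in operator norm. -/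
theorem tendsto_aeval_specProj {A : H →L[ℂ] H} (hc : IsCompactOperator A)
    (hA : (A : H →ₗ[ℂ] H).IsSymmetric) {R : ℝ} (hR : ‖A‖ ≤ R) {q : ℕ → Polynomial ℝ}
    (hq : ∀ n, ∀ y ∈ Set.Icc (-R) R, |(q n).eval y| ≤ 2)
    (hq0 : ∀ y ∈ Set.Icc (-R) R, y ≤ 0 → Tendsto (fun n => (q n).eval y) atTop (𝓝 0))
    (hq1 : ∀ y ∈ Set.Icc (-R) R, 0 < y → Tendsto (fun n => (q n).eval y) atTop (𝓝 1)) (v : H) :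
    Tendsto (fun n => Polynomial.aeval A (q n) v) atTop (𝓝 (specProj A (Set.Ioi 0) v)) := by
  have hsa : IsSelfAdjoint A := hA.isSelfAdjoint
  refine tendsto_apply_of_mem_closure (fun n => norm_aeval_le hsa hR zero_le_two (hq n))
    (D := spectralSpan A Set.univ) (fun v hv => ?_)
    (by rw [spectralSpan_univ_topologicalClosure hc hA]; trivial)
  obtain ⟨s, f, hf, rfl⟩ := exists_finset_of_mem_spectralSpan hv
  simp_rw [map_sum]
  refine tendsto_finsetSum _ fun x _ => ?_
  simp_rw [aeval_apply_of_eigen (hf x)]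
  rcases eq_or_ne (f x) 0 with h0 | h0
  · simp [h0]
  have hx : (x : ℝ) ∈ Set.Icc (-R) R := by
    have h1 := A.le_opNorm (f x)
    rw [hf x, norm_smul, Complex.norm_real, Real.norm_eq_abs] at h1
    exact Set.mem_Icc.2 (abs_le.1 ((le_of_mul_le_mul_right h1 (norm_pos_iff.2 h0)).trans hR))
  rcases le_or_gt (x : ℝ) 0 with h | h
  · rw [specProj_apply_of_eigen_notMem hA (S := Set.Ioi 0) (not_lt.2 h) (hf x)]
    have := ((Complex.continuous_ofReal.tendsto _).comp (hq0 x hx h)).smul_const (f x)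
    rwa [Complex.ofReal_zero, zero_smul] at this
  · rw [specProj_apply_of_eigen (S := Set.Ioi 0) h (hf x)]
    have := ((Complex.continuous_ofReal.tendsto _).comp (hq1 x hx h)).smul_const (f x)
    rwa [Complex.ofReal_one, one_smul] at this

end PolynomialApproximation

/-! ### Measurability of the information-spectrum integrand. -/

section Measurability

variable {X : Type*} [MeasurableSpace X] {H : Type*} [NormedAddCommGroup H]
  [InnerProductSpace ℂ H] [CompleteSpace H] (W : Channel X H)

theorem prob_one_sub {ρ : H →L[ℂ] H} (hρ : IsPureState ρ) (T : H →L[ℂ] H) :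
    prob ρ (1 - T) = 1 - prob ρ T := by
  obtain ⟨ψ, hψ, rfl⟩ := hρ
  rw [prob_rankOne, prob_rankOne, sub_apply, inner_sub_right, one_apply_eq_self,
    inner_self_eq_norm_sq_to_K, hψ]
  simp

/-- The projection need not depend continuously on `x`, but polynomials in `W_x - cρ` do depend
measurably on `x`. Sandwiched between two copies of the pure state, their norms converge pointwise
to the probability. -/
theorem stronglyMeasurable_prob_specProj (hW : ∀ x, IsPureState (W.out x)) {ρ : H →L[ℂ] H}
    (hc : IsCompactOperator ρ) (hs : (ρ : H →ₗ[ℂ] H).IsSymmetric) (c : ℝ) :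
    StronglyMeasurable fun x =>
      prob (W.out x) (specProj (W.out x - (c : ℂ) • ρ) (Set.Iic 0)) := by
  obtain ⟨q, hq, hq0, hq1⟩ := exists_polynomial_tendsto_indicator (1 + ‖(c : ℂ) • ρ‖)
  have hAc : ∀ x, IsCompactOperator (W.out x - (c : ℂ) • ρ) := fun x =>
    isCompactOperator_sub_smul (hW x).isCompactOperator hc c
  have hAs : ∀ x, ((W.out x - (c : ℂ) • ρ : H →L[ℂ] H) : H →ₗ[ℂ] H).IsSymmetric := fun x =>
    isSymmetric_sub_smul (W.isDensityOperator x).1.isSymmetric hs c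
  have h1 : (fun x => prob (W.out x) (specProj (W.out x - (c : ℂ) • ρ) (Set.Iic 0))) =
      fun x => 1 - prob (W.out x) (specProj (W.out x - (c : ℂ) • ρ) (Set.Ioi 0)) := by
    ext x
    rw [specProj_Ioi_eq (hAc x) (hAs x), prob_one_sub (hW x), sub_sub_cancel]
  rw [h1]
  refine stronglyMeasurable_const.sub ?_
  refine stronglyMeasurable_of_tendsto (u := atTop) (f := fun n x =>
    ‖W.out x * Polynomial.aeval (W.out x - (c : ℂ) • ρ) (q n) * W.out x‖) (fun n => ?_) ?_
  · have h2 : StronglyMeasurable fun x => Polynomial.aeval (W.out x - (c : ℂ) • ρ) (q n) :=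
      ((q n).continuous_aeval).comp_stronglyMeasurable
        (W.stronglyMeasurable.sub stronglyMeasurable_const)
    exact ((W.stronglyMeasurable.mul h2).mul W.stronglyMeasurable).norm
  · rw [tendsto_pi_nhds]
    intro x
    have hR : ‖W.out x - (c : ℂ) • ρ‖ ≤ 1 + ‖(c : ℂ) • ρ‖ :=
      (norm_sub_le _ _).trans (by rw [(hW x).norm_eq_one])
    rw [prob_eq_norm_of_isPureState (hW x) (isPositive_specProj _ _)]
    have hnorm : ∀ T : H →L[ℂ] H, ‖W.out x * T * W.out x‖ = ‖trace (W.out x * T)‖ := fun T => by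
      rw [mul_mul_eq_of_isPureState (hW x), norm_smul, (hW x).norm_eq_one, mul_one]
    simp_rw [hnorm]
    obtain ⟨ψ, hψ, h⟩ := hW x
    have h3 := tendsto_aeval_specProj (hAc x) (hAs x) hR hq hq0 hq1 ψ
    have h4 : ∀ T : H →L[ℂ] H, trace (W.out x * T) = ⟪ψ, T ψ⟫_ℂ := fun T => by
      rw [h, trace_rankOne_mul]
    simp_rw [h4]
    exact (tendsto_const_nhds.inner h3).norm

end Measurability

/-! ### Suprema defined by limsup conditions, and exponential scales. -/

section Limsup

theorem limsup_coe_le_iff {f : ℕ → ℝ} {ε : ℝ} :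
    limsup (fun N => (f N : EReal)) atTop ≤ (ε : EReal) ↔
      ∀ η > 0, ∀ᶠ N in atTop, f N ≤ ε + η := by
  constructor
  · intro h η hη
    have h1 : limsup (fun N => (f N : EReal)) atTop < ((ε + η : ℝ) : EReal) :=
      h.trans_lt (by exact_mod_cast lt_add_of_pos_right ε hη)
    filter_upwards [eventually_lt_of_limsup_lt h1] with N hN
    exact_mod_cast hN.le
  · intro h
    refine le_of_forall_gt_imp_ge_of_dense fun z hz => ?_
    obtain ⟨r, hr1, hr2⟩ := EReal.lt_iff_exists_real_btwn.1 hz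
    have hr : 0 < r - ε := sub_pos.2 (by exact_mod_cast hr1)
    refine le_trans (limsup_le_of_le (by isBoundedDefault) ?_) hr2.le
    filter_upwards [h _ hr] with N hN
    exact_mod_cast (by linarith : f N ≤ r)

/-- If `b` is admissible for `g`, then every `r < b` is admissible for `f`, taking `δ = b - r`. -/
theorem sSup_limsup_le_of_eventually_le_add {f g : ℝ → ℕ → ℝ} {ε : ℝ}
    (h : ∀ b, ∀ δ > 0, ∃ e : ℕ → ℝ, Tendsto e atTop (𝓝 0) ∧
      ∀ᶠ N in atTop, f b N ≤ g (b + δ) N + e N) :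
    sSup {r : EReal | ∃ b : ℝ, r = (b : EReal) ∧
        limsup (fun N => (g b N : EReal)) atTop ≤ (ε : EReal)} ≤
      sSup {r : EReal | ∃ b : ℝ, r = (b : EReal) ∧
        limsup (fun N => (f b N : EReal)) atTop ≤ (ε : EReal)} := by
  refine sSup_le ?_
  rintro _ ⟨b, rfl, hb⟩
  refine le_of_forall_lt fun z hz => ?_
  obtain ⟨r, hr1, hr2⟩ := EReal.lt_iff_exists_real_btwn.1 hz
  have hδ : 0 < b - r := sub_pos.2 (by exact_mod_cast hr2)
  refine hr1.trans_le (le_sSup ⟨r, rfl, limsup_coe_le_iff.2 fun η hη => ?_⟩)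
  obtain ⟨e, he, hfe⟩ := h r (b - r) hδ
  filter_upwards [hfe, limsup_coe_le_iff.1 hb (η / 2) (half_pos hη),
    he.eventually_le_const (half_pos hη)] with N h1 h2 h3
  rw [add_sub_cancel] at h1
  linarith

theorem setOf_neg_log_le {a b : ℝ} (ha : 0 < a) :
    {x : ℝ | 0 < x ∧ (-1 / a) * Real.log x ≤ b} = Set.Ici (Real.exp (-(a * b))) := by
  ext x
  simp only [Set.mem_ofPred_eq, Set.mem_Ici]
  have key : (-1 / a) * Real.log x ≤ b ↔ -(a * b) ≤ Real.log x := by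
    rw [div_mul_eq_mul_div, div_le_iff₀ ha]
    constructor <;> intro h <;> linarith
  rw [key]
  constructor
  · rintro ⟨h1, h2⟩
    exact (Real.le_log_iff_exp_le h1).1 h2
  · intro h
    have h1 := (Real.exp_pos _).trans_le h
    exact ⟨h1, (Real.le_log_iff_exp_le h1).2 h⟩

theorem tendsto_exp_neg_mul {a : ℕ → ℝ} (ha : Tendsto a atTop atTop) {δ : ℝ} (hδ : 0 < δ) :
    Tendsto (fun N => Real.exp (-(a N * δ))) atTop (𝓝 0) :=
  Real.tendsto_exp_neg_atTop_nhds_zero.comp (ha.atTop_mul_const hδ)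

end Limsup

/-! ### Averaging the pointwise comparison over the input. -/

section SingleLetter

variable {X : Type*} [MeasurableSpace X] {H : Type*} [NormedAddCommGroup H]
  [InnerProductSpace ℂ H] [CompleteSpace H] (W : Channel X H)

theorem prob_le_one_of_isPureState {ρ : H →L[ℂ] H} (hρ : IsPureState ρ) (A : H →L[ℂ] H)
    (S : Set ℝ) : prob ρ (specProj A S) ≤ 1 := by
  obtain ⟨ψ, hψ, rfl⟩ := hρ
  rw [prob_rankOne_specProj]
  exact pow_le_one₀ (norm_nonneg _) (hψ ▸ norm_specProj_le A S ψ)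

theorem integrable_prob_specProj (hW : ∀ x, IsPureState (W.out x)) (P : ProbabilityMeasure X)
    (c : ℝ) :
    Integrable (fun x => prob (W.out x) (specProj (W.out x - (c : ℂ) • W.avg P) (Set.Iic 0)))
      (P : Measure X) := by
  refine Integrable.of_bound (stronglyMeasurable_prob_specProj W hW
    (avg_isCompactOperator W hW P) (avg_isSymmetric W hW P) c).aestronglyMeasurable 1
    (ae_of_all _ fun x => ?_)
  rw [Real.norm_eq_abs, abs_of_nonneg (prob_nonneg_of_isPureState (hW x) (isPositive_specProj _ _))]
  exact prob_le_one_of_isPureState (hW x) _ _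

theorem integral_prob_specProj_sub_smul_le (hW : ∀ x, IsPureState (W.out x))
    (P : ProbabilityMeasure X) {c t : ℝ} (hc : 0 ≤ c) (ht : 0 ≤ t) :
    ∫ x, prob (W.out x) (specProj (W.out x - (c : ℂ) • W.avg P) (Set.Iic 0)) ∂(P : Measure X) ≤
      prob (W.avg P) (specProj (W.avg P) (Set.Ici t)) + c * t := by
  have h1 := integrable_prob W hW P (isPositive_specProj (W.avg P) (Set.Ici t))
  rw [prob_avg W hW P (isPositive_specProj _ _)]
  calc _ ≤ ∫ x, (prob (W.out x) (specProj (W.avg P) (Set.Ici t)) + c * t) ∂(P : Measure X) := by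
        refine integral_mono (integrable_prob_specProj W hW P c)
          (h1.add (integrable_const _)) fun x => ?_
        obtain ⟨ψ, hψ, h⟩ := hW x
        simp only [h]
        exact prob_specProj_sub_smul_le hψ (avg_isCompactOperator W hW P)
          (avg_isSymmetric W hW P) (re_inner_avg_self_nonneg W hW P) hc ht
    _ = _ := by
        rw [integral_add h1 (integrable_const _)]
        simp

theorem prob_avg_specProj_le (hW : ∀ x, IsPureState (W.out x))
    (P : ProbabilityMeasure X) {c t s : ℝ} (hc : 0 ≤ c) (hs : 0 ≤ s) (hcts : 1 ≤ c * t * s ^ 2) :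
    prob (W.avg P) (specProj (W.avg P) (Set.Ici t)) ≤
      ∫ x, prob (W.out x) (specProj (W.out x - (c : ℂ) • W.avg P) (Set.Iic 0)) ∂(P : Measure X)
        + 2 * s := by
  have h1 := integrable_prob W hW P (isPositive_specProj (W.avg P) (Set.Ici t))
  have h2 := integrable_prob_specProj W hW P c
  rw [prob_avg W hW P (isPositive_specProj _ _)]
  calc _ ≤ ∫ x, (prob (W.out x) (specProj (W.out x - (c : ℂ) • W.avg P) (Set.Iic 0)) + 2 * s)
          ∂(P : Measure X) := by
        refine integral_mono h1 (h2.add (integrable_const _)) fun x => ?_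
        obtain ⟨ψ, hψ, h⟩ := hW x
        simp only [h]
        exact prob_specProj_le hψ (avg_isCompactOperator W hW P)
          (avg_isSymmetric W hW P) (re_inner_avg_self_nonneg W hW P) hc hs hcts
    _ = _ := by
        rw [integral_add h2 (integrable_const _)]
        simp

end SingleLetter

/-! ### Equality of the two spectral quantities. -/

section Spectra

variable {X : ℕ → Type*} [∀ N, MeasurableSpace (X N)] {H : ℕ → Type*}
  [∀ N, NormedAddCommGroup (H N)] [∀ N, InnerProductSpace ℂ (H N)] [∀ N, CompleteSpace (H N)]

theorem infoSpectrum_eq_supEntropySpectrum {a : ℕ → ℝ} (ha : Tendsto a atTop atTop)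
    {W : ∀ N, Channel (X N) (H N)} (hW : ∀ N x, IsPureState ((W N).out x)) (ε : ℝ)
    (P : ∀ N, ProbabilityMeasure (X N)) :
    infoSpectrum a ε P W = supEntropySpectrum a ε (fun N => (W N).avg (P N)) := by
  rw [infoSpectrum, supEntropySpectrum]
  apply le_antisymm
  · refine sSup_limsup_le_of_eventually_le_add
      (f := fun b N => prob ((W N).avg (P N)) (specProj ((W N).avg (P N))
        {x : ℝ | 0 < x ∧ (-1 / a N) * Real.log x ≤ b}))
      (g := fun b N => ∫ x, prob ((W N).out x)
        (specProj ((W N).out x - ((Real.exp (a N * b) : ℝ) : ℂ) • (W N).avg (P N)) (Set.Iic 0))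
        ∂(P N : Measure (X N))) fun b δ hδ =>
      ⟨fun N => 2 * Real.exp (-(a N * (δ / 2))), ?_, ?_⟩
    · simpa using (tendsto_exp_neg_mul ha (half_pos hδ)).const_mul 2
    · filter_upwards [ha.eventually_gt_atTop 0] with N hN
      rw [setOf_neg_log_le hN]
      -- Here `c = exp (a (b + δ))`, `t = exp (-a b)` and `s = exp (-a δ / 2)`, so `c t s² = 1`.
      refine prob_avg_specProj_le (W N) (hW N) (P N) (Real.exp_pos _).le (Real.exp_pos _).le ?_
      rw [sq, ← Real.exp_add, ← Real.exp_add, ← Real.exp_add]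
      exact le_of_eq (by rw [eq_comm, Real.exp_eq_one_iff]; ring)
  · refine sSup_limsup_le_of_eventually_le_add
      (g := fun b N => prob ((W N).avg (P N)) (specProj ((W N).avg (P N))
        {x : ℝ | 0 < x ∧ (-1 / a N) * Real.log x ≤ b}))
      (f := fun b N => ∫ x, prob ((W N).out x)
        (specProj ((W N).out x - ((Real.exp (a N * b) : ℝ) : ℂ) • (W N).avg (P N)) (Set.Iic 0))
        ∂(P N : Measure (X N))) fun b δ hδ =>
      ⟨fun N => Real.exp (-(a N * δ)), tendsto_exp_neg_mul ha hδ, ?_⟩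
    filter_upwards [ha.eventually_gt_atTop 0] with N hN
    rw [setOf_neg_log_le hN]
    refine (integral_prob_specProj_sub_smul_le (W N) (hW N) (P N) (Real.exp_pos _).le
      (Real.exp_pos (-(a N * (b + δ)))).le).trans (le_of_eq ?_)
    rw [← Real.exp_add]
    congr 2
    ring

end Spectra

/-! ### Sequential measurement of projective tests. -/

section SequentialDecoding

variable {H : Type*} [NormedAddCommGroup H] [InnerProductSpace ℂ H] [CompleteSpace H]

theorem IsStarProjection.inner_left {P : H →L[ℂ] H} (hP : IsStarProjection P) (u v : H) :
    ⟪P u, v⟫_ℂ = ⟪u, P v⟫_ℂ := by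
  have h := (ContinuousLinearMap.IsPositive.of_isStarProjection hP).isSymmetric u v
  simpa using h

theorem IsStarProjection.apply_apply {P : H →L[ℂ] H} (hP : IsStarProjection P) (v : H) :
    P (P v) = P v := by
  rw [← mul_apply_eq_comp, hP.isIdempotentElem.eq]

theorem IsStarProjection.inner_self {P : H →L[ℂ] H} (hP : IsStarProjection P) (v : H) :
    ⟪v, P v⟫_ℂ = (‖P v‖ : ℂ) ^ 2 := by
  rw [← IsStarProjection.apply_apply hP, ← IsStarProjection.inner_left hP,
    inner_self_eq_norm_sq_to_K, IsStarProjection.apply_apply hP]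
  rfl

theorem IsStarProjection.norm_apply_le {P : H →L[ℂ] H} (hP : IsStarProjection P) (v : H) :
    ‖P v‖ ≤ ‖v‖ := by
  have h : ‖P v‖ ^ 2 ≤ ‖v‖ * ‖P v‖ := by
    have h1 := norm_inner_le_norm (𝕜 := ℂ) v (P v)
    rw [IsStarProjection.inner_self hP] at h1
    simpa using h1
  rcases (norm_nonneg (P v)).eq_or_lt with h0 | h0
  · rw [← h0]; exact norm_nonneg v
  · rw [sq] at h
    exact le_of_mul_le_mul_right h h0

theorem prob_rankOne_of_isStarProjection {P : H →L[ℂ] H} (hP : IsStarProjection P) (ψ : H) :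
    prob (InnerProductSpace.rankOne ℂ ψ ψ) P = ‖P ψ‖ ^ 2 := by
  rw [prob_rankOne, IsStarProjection.inner_self hP]
  norm_cast

/-- The operator of passing all of the first `k` tests `1 - P j`, one after the other. -/
noncomputable def passOp (P : ℕ → H →L[ℂ] H) : ℕ → H →L[ℂ] H
  | 0 => 1
  | k + 1 => (1 - P k) * passOp P k

/-- The deviation after one more test is `P k ψ` plus the image under `1 - P k` of the earlier
deviation. These are orthogonal, so squared norms add with no cross terms. -/
theorem norm_sub_passOp_sq_le {P : ℕ → H →L[ℂ] H} (hP : ∀ j, IsStarProjection (P j)) (ψ : H)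
    (k : ℕ) : ‖ψ - passOp P k ψ‖ ^ 2 ≤ ∑ j ∈ Finset.range k, ‖P j ψ‖ ^ 2 := by
  induction k with
  | zero => simp [passOp]
  | succ k ih =>
    rw [Finset.sum_range_succ]
    set u := ψ - passOp P k ψ with hu
    have h1 : ψ - passOp P (k + 1) ψ = P k ψ + (1 - P k) u := by
      simp only [passOp, mul_apply_eq_comp, sub_apply, one_apply_eq_self, hu, map_sub]
      abel
    have h0 : ⟪P k ψ, (1 - P k) u⟫_ℂ = 0 := by
      rw [IsStarProjection.inner_left (hP k), sub_apply, map_sub, one_apply_eq_self,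
        IsStarProjection.apply_apply (hP k), sub_self, inner_zero_right]
    have h2 : ‖(1 - P k) u‖ ≤ ‖u‖ := IsStarProjection.norm_apply_le (hP k).one_sub u
    rw [h1, @norm_add_sq ℂ, h0]
    have h3 := pow_le_pow_left₀ (norm_nonneg _) h2 2
    simp only [map_zero, mul_zero, add_zero]
    linarith

/-- The effect that the sequence of tests `1 - P j` fails for the first time at `i`. -/
noncomputable def sequentialEffect (P : ℕ → H →L[ℂ] H) (i : ℕ) : H →L[ℂ] H :=
  ContinuousLinearMap.adjoint (passOp P i) * P i * passOp P i

theorem sequentialEffect_isPositive {P : ℕ → H →L[ℂ] H} (hP : ∀ j, IsStarProjection (P j))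
    (i : ℕ) : (sequentialEffect P i).IsPositive := by
  have h := (ContinuousLinearMap.IsPositive.of_isStarProjection (hP i)).adjoint_conj (passOp P i)
  exact h

theorem sequentialEffect_eq_sub {P : ℕ → H →L[ℂ] H} (hP : ∀ j, IsStarProjection (P j)) (i : ℕ) :
    sequentialEffect P i = ContinuousLinearMap.adjoint (passOp P i) * passOp P i -
      ContinuousLinearMap.adjoint (passOp P (i + 1)) * passOp P (i + 1) := by
  have h1 : ContinuousLinearMap.adjoint (passOp P (i + 1)) =
      ContinuousLinearMap.adjoint (passOp P i) * (1 - P i) := by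
    rw [← ContinuousLinearMap.star_eq_adjoint, ← ContinuousLinearMap.star_eq_adjoint, passOp,
      star_mul, (hP i).one_sub.isSelfAdjoint.star_eq]
  have h2 : (1 - P i) * (1 - P i) = 1 - P i := (hP i).one_sub.isIdempotentElem.eq
  rw [h1, passOp, mul_assoc _ (1 - P i), ← mul_assoc (1 - P i) (1 - P i), h2, sequentialEffect]
  noncomm_ring

theorem sum_sequentialEffect {P : ℕ → H →L[ℂ] H} (hP : ∀ j, IsStarProjection (P j)) (k : ℕ) :
    ∑ i ∈ Finset.range k, sequentialEffect P i =
      1 - ContinuousLinearMap.adjoint (passOp P k) * passOp P k := by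
  simp_rw [sequentialEffect_eq_sub hP]
  rw [Finset.sum_range_sub']
  simp only [passOp]
  rw [← ContinuousLinearMap.star_eq_adjoint, star_one, one_mul]

theorem re_inner_sequentialEffect {P : ℕ → H →L[ℂ] H} (hP : ∀ j, IsStarProjection (P j)) (ψ : H)
    (i : ℕ) : (⟪ψ, sequentialEffect P i ψ⟫_ℂ).re = ‖P i (passOp P i ψ)‖ ^ 2 := by
  rw [sequentialEffect, mul_apply_eq_comp, mul_apply_eq_comp,
    ContinuousLinearMap.adjoint_inner_right, IsStarProjection.inner_self (hP i)]
  norm_cast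

/-- The earlier tests move `ψ` by `s`, which costs at most `2 s` in detection probability. Since
`s²` is the controlled quantity, `2 s ≤ κ + s² / κ` trades it in linearly, a form that can be
averaged over codewords. -/
theorem norm_sq_le_re_inner_sequentialEffect {P : ℕ → H →L[ℂ] H}
    (hP : ∀ j, IsStarProjection (P j)) {ψ : H} (hψ : ‖ψ‖ = 1) {κ : ℝ} (hκ : 0 < κ) (i : ℕ) :
    ‖P i ψ‖ ^ 2 ≤ (⟪ψ, sequentialEffect P i ψ⟫_ℂ).re + κ +
      (∑ j ∈ Finset.range i, ‖P j ψ‖ ^ 2) / κ := by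
  rw [re_inner_sequentialEffect hP]
  have h1 := norm_sub_passOp_sq_le hP ψ i
  set s := ‖ψ - passOp P i ψ‖ with hs
  set y := ‖P i (passOp P i ψ)‖ with hy
  have h2 : ‖P i ψ‖ ≤ y + s := by
    have h3 : P i ψ = P i (passOp P i ψ) + P i (ψ - passOp P i ψ) := by rw [map_sub]; abel
    rw [h3]
    exact (norm_add_le _ _).trans
      (add_le_add le_rfl (IsStarProjection.norm_apply_le (hP i) _))
  have h4 : ‖P i ψ‖ ≤ 1 := hψ ▸ IsStarProjection.norm_apply_le (hP i) ψ
  have h5 : s ^ 2 / κ ≤ (∑ j ∈ Finset.range i, ‖P j ψ‖ ^ 2) / κ :=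
    div_le_div_of_nonneg_right h1 hκ.le
  have h6 : 2 * s ≤ κ + s ^ 2 / κ := by
    have : κ + s ^ 2 / κ - 2 * s = (κ - s) ^ 2 / κ := by field_simp; ring
    have h7 : 0 ≤ (κ - s) ^ 2 / κ := by positivity
    linarith
  have hs0 : 0 ≤ s := norm_nonneg _
  have hy0 : 0 ≤ y := norm_nonneg _
  have hp0 : 0 ≤ ‖P i ψ‖ := norm_nonneg _
  have h8 : ‖P i ψ‖ ^ 2 ≤ y ^ 2 + 2 * s := by
    rcases le_or_gt ‖P i ψ‖ s with h | h
    · nlinarith [sq_nonneg y]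
    · have : (‖P i ψ‖ - s) ^ 2 ≤ y ^ 2 := pow_le_pow_left₀ (by linarith) (by linarith) 2
      nlinarith
  linarith

end SequentialDecoding

/-! ### Construction of codes. -/

section Codes

variable {X : Type*} [MeasurableSpace X] {H : Type*} [NormedAddCommGroup H]
  [InnerProductSpace ℂ H] [CompleteSpace H] {W : Channel X H}

theorem exists_code_of_isStarProjection (hW : ∀ x, IsPureState (W.out x)) {M : ℕ} (hM : 0 < M)
    (x : ℕ → X) {P : ℕ → H →L[ℂ] H} (hP : ∀ j, IsStarProjection (P j)) {κ B : ℝ} (hκ : 0 < κ)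
    (hB : ∀ i < M, 1 - prob (W.out (x i)) (P i) + κ +
      (∑ j ∈ Finset.range i, prob (W.out (x i)) (P j)) / κ ≤ B) :
    ∃ Φ : Code X H, Φ.size = M ∧ Φ.error W ≤ B := by
  have hRpos : (ContinuousLinearMap.adjoint (passOp P M) * passOp P M).IsPositive :=
    ContinuousLinearMap.isPositive_adjoint_comp_self (passOp P M)
  set R := ContinuousLinearMap.adjoint (passOp P M) * passOp P M with hR
  have hleft : ∀ i : ℕ, (if i = 0 then R else 0).IsPositive := fun i => by
    split_ifs
    exacts [hRpos, ContinuousLinearMap.isPositive_zero]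
  -- The leftover effect `R`, where no test fires, is given to message `0` to complete the POVM;
  -- this can only lower the error.
  refine ⟨⟨M, hM, fun i => x i, fun i => sequentialEffect P i + if (i : ℕ) = 0 then R else 0,
    fun i => (sequentialEffect_isPositive hP i).add (hleft i), ?_⟩, rfl, ?_⟩
  · rw [Fin.sum_univ_eq_sum_range
      (fun i => sequentialEffect P i + if i = 0 then R else 0) M, Finset.sum_add_distrib,
      sum_sequentialEffect hP, Finset.sum_ite_eq' (Finset.range M) 0 fun _ => R,
      if_pos (Finset.mem_range.2 hM), ← hR, sub_add_cancel]
  · have hM' : (0 : ℝ) < M := by exact_mod_cast hM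
    have key : ∀ i : Fin M, prob (W.out (x i))
        (1 - (sequentialEffect P i + if (i : ℕ) = 0 then R else 0)) ≤ B := by
      intro i
      refine le_trans ?_ (hB i i.2)
      rw [prob_one_sub (hW _)]
      obtain ⟨ψ, hψ, h⟩ := hW (x i)
      simp only [h, prob_rankOne_of_isStarProjection (hP _)]
      rw [prob_rankOne, add_apply, inner_add_right, Complex.add_re]
      have h1 := norm_sq_le_re_inner_sequentialEffect hP hψ hκ i
      have h2 : 0 ≤ (⟪ψ, (if (i : ℕ) = 0 then R else 0) ψ⟫_ℂ).re :=
        (hleft i).re_inner_nonneg_right ψ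
      linarith
    have h3 := Finset.sum_le_sum fun i (_ : i ∈ Finset.univ) => key i
    rw [Finset.sum_const, Finset.card_univ, Fintype.card_fin, nsmul_eq_mul] at h3
    simp only [Code.error]
    rw [one_div, inv_mul_le_iff₀ hM']
    exact h3

open ComplexOrder in
/-- Mixing the decoder of a code with the uniform one raises its error to any prescribed value
below the error of the uniform decoder. -/
theorem exists_code_error_eq (hW : ∀ x, IsPureState (W.out x)) (Φ : Code X H) {l : ℝ}
    (h1 : Φ.error W ≤ l) (h2 : l ≤ 1 - 1 / (Φ.size : ℝ)) :
    ∃ Ψ : Code X H, Ψ.size = Φ.size ∧ Ψ.error W = l := by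
  have hM : (0 : ℝ) < Φ.size := by exact_mod_cast Φ.size_pos
  rcases h1.eq_or_lt with h1 | h1
  · exact ⟨Φ, rfl, h1⟩
  set u : ℝ := 1 - 1 / (Φ.size : ℝ) with hu
  have hue : 0 < u - Φ.error W := by linarith
  -- The error is affine in the weight of the uniform decoder, whose error is `u`; this weight
  -- produces `l`.
  set s : ℝ := (l - Φ.error W) / (u - Φ.error W) with hs
  have hs0 : 0 ≤ s := div_nonneg (by linarith) hue.le
  have hs1 : s ≤ 1 := (div_le_one hue).2 (by linarith)
  have hc : ∀ r : ℝ, 0 ≤ r → (0 : ℂ) ≤ (r : ℂ) := fun r hr => Complex.zero_le_real.2 hr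
  refine ⟨⟨Φ.size, Φ.size_pos, Φ.encoder, fun i => ((1 - s : ℝ) : ℂ) • Φ.decoder i +
    ((s / Φ.size : ℝ) : ℂ) • (1 : H →L[ℂ] H), fun i => ?_, ?_⟩, rfl, ?_⟩
  · exact ((Φ.decoder_isPositive i).smul_of_nonneg (hc _ (by linarith))).add
      (ContinuousLinearMap.isPositive_one.smul_of_nonneg (hc _ (div_nonneg hs0 hM.le)))
  · rw [Finset.sum_add_distrib, ← Finset.smul_sum, Φ.decoder_sum, Finset.sum_const,
      Finset.card_univ, Fintype.card_fin, ← Nat.cast_smul_eq_nsmul ℂ, smul_smul, ← add_smul]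
    have : ((1 - s : ℝ) : ℂ) + (Φ.size : ℂ) * ((s / Φ.size : ℝ) : ℂ) = 1 := by
      have hM0 : (Φ.size : ℂ) ≠ 0 := by exact_mod_cast hM.ne'
      push_cast
      field_simp
      ring
    rw [this, one_smul]
  · have key : ∀ i, prob (W.out (Φ.encoder i)) (1 - (((1 - s : ℝ) : ℂ) • Φ.decoder i +
        ((s / Φ.size : ℝ) : ℂ) • (1 : H →L[ℂ] H))) =
        (1 - s) * prob (W.out (Φ.encoder i)) (1 - Φ.decoder i) + s * u := by
      intro i
      rw [prob_one_sub (hW _), prob_one_sub (hW _)]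
      obtain ⟨ψ, hψ, h⟩ := hW (Φ.encoder i)
      rw [h, prob_rankOne, prob_rankOne, add_apply, smul_apply, smul_apply, one_apply_eq_self,
        inner_add_right, inner_smul_right, inner_smul_right, inner_self_eq_norm_sq_to_K, hψ,
        Complex.add_re, Complex.re_ofReal_mul, Complex.re_ofReal_mul, hu]
      simp
      ring
    have he : Φ.error W = 1 / (Φ.size : ℝ) *
      ∑ i, prob (W.out (Φ.encoder i)) (1 - Φ.decoder i) := rfl
    have hsum : ∑ i, prob (W.out (Φ.encoder i)) (1 - (((1 - s : ℝ) : ℂ) • Φ.decoder i +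
        ((s / Φ.size : ℝ) : ℂ) • (1 : H →L[ℂ] H))) =
        (1 - s) * ∑ i, prob (W.out (Φ.encoder i)) (1 - Φ.decoder i) + Φ.size * (s * u) := by
      rw [Finset.sum_congr rfl fun i _ => key i, Finset.sum_add_distrib, ← Finset.mul_sum,
        Finset.sum_const, Finset.card_univ, Fintype.card_fin, nsmul_eq_mul]
    have h3 : 1 / (Φ.size : ℝ) * ((1 - s) * ∑ i, prob (W.out (Φ.encoder i)) (1 - Φ.decoder i) +
        Φ.size * (s * u)) = (1 - s) * Φ.error W + s * u := by
      rw [he]; field_simp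
    refine (congrArg (1 / (Φ.size : ℝ) * ·) hsum).trans (h3.trans ?_)
    have h4 : s * (u - Φ.error W) = l - Φ.error W := div_mul_cancel₀ _ hue.ne'
    linarith

theorem exists_code_error_eq_zero (hW : ∀ x, IsPureState (W.out x)) (x : X) :
    ∃ Φ : Code X H, Φ.size = 1 ∧ Φ.error W = 0 := by
  refine ⟨⟨1, one_pos, fun _ => x, fun _ => 1, fun _ => ContinuousLinearMap.isPositive_one,
    by simp⟩, rfl, ?_⟩
  obtain ⟨ψ, hψ, h⟩ := hW x
  simp [Code.error, h, prob_rankOne]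

/-- Projecting onto the direction of `v = {W_P < t} ψ` detects `ψ` as well as the full projection
`{W_P < t}` does, since `⟪v, ψ⟫ = ‖v‖²`. Being of rank one, its probability in `W_P` is a single
quadratic form value, at most `t`. If `v = 0`, the zero test suffices. -/
theorem exists_unit_test (hW : ∀ x, IsPureState (W.out x)) (P : ProbabilityMeasure X) {t : ℝ}
    (ht : 0 ≤ t) (x : X) :
    ∃ T : H →L[ℂ] H, IsStarProjection T ∧ prob (W.avg P) T ≤ t ∧
      1 - prob (W.out x) (specProj (W.avg P) (Set.Ici t)) ≤ prob (W.out x) T := by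
  have hs := avg_isSymmetric W hW P
  have hc := avg_isCompactOperator W hW P
  obtain ⟨ψ, hψ, h⟩ := hW x
  set v := ψ - specProj (W.avg P) (Set.Ici t) ψ with hv
  have hq : ‖v‖ ^ 2 = 1 - ‖specProj (W.avg P) (Set.Ici t) ψ‖ ^ 2 := by
    rw [hv, norm_sub_specProj_sq, hψ]; norm_num
  have hv' : specProj (W.avg P) (Set.Iio t) ψ = v := by
    rw [specProj_Iio_eq hc hs]; rfl
  rw [h, prob_rankOne_specProj, ← hq]
  rcases eq_or_ne v 0 with h0 | h0
  · refine ⟨0, IsStarProjection.zero _, ?_, ?_⟩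
    · have : prob (W.avg P) 0 = 0 := by simp [prob, trace]
      rwa [this]
    · rw [prob_rankOne, h0]; simp
  have hn : 0 < ‖v‖ := norm_pos_iff.2 h0
  set w : H := ((‖v‖⁻¹ : ℝ) : ℂ) • v with hw
  have hw1 : ‖w‖ = 1 := by
    rw [hw, norm_smul, Complex.norm_real, norm_inv, norm_norm, inv_mul_cancel₀ hn.ne']
  have hT : IsStarProjection (InnerProductSpace.rankOne ℂ w w) :=
    ⟨InnerProductSpace.isIdempotentElem_rankOne_self hw1,
      (InnerProductSpace.isPositive_rankOne_self w).isSelfAdjoint⟩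
  refine ⟨InnerProductSpace.rankOne ℂ w w, hT, ?_, ?_⟩
  · rw [prob_avg W hW P (InnerProductSpace.isPositive_rankOne_self w)]
    have h1 : ∀ y, prob (W.out y) (InnerProductSpace.rankOne ℂ w w) =
        (⟪w, W.out y w⟫_ℂ).re := by
      intro y
      obtain ⟨φ, -, h⟩ := hW y
      rw [h, prob_rankOne, re_inner_rankOne_self, re_inner_rankOne_self, norm_inner_symm]
    simp_rw [h1]
    rw [← re_inner_avg_self W hW P]
    have h2 := re_inner_specProj_le hs (S := Set.Iio t) (t := t) (fun x hx => le_of_lt hx) w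
    have h3 : specProj (W.avg P) (Set.Iio t) w = w := by
      rw [hw, map_smul, ← hv', specProj_specProj]
    rwa [h3, hw1, one_pow, mul_one] at h2
  · rw [prob_rankOne, re_inner_rankOne_self]
    have h1 : ⟪v, ψ⟫_ℂ = (‖v‖ : ℂ) ^ 2 := by
      rw [← hv', inner_specProj_left, inner_specProj_self]
    rw [hw, inner_smul_left, h1, Complex.conj_ofReal, norm_mul, Complex.norm_real, norm_pow,
      Complex.norm_real, norm_norm, norm_inv, norm_norm, sq ‖v‖, inv_mul_cancel_left₀ hn.ne', sq]

/-- Greedy random coding for a pure channel. -/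
theorem exists_code_error_le (hW : ∀ x, IsPureState (W.out x)) (P : ProbabilityMeasure X)
    {t κ : ℝ} (ht : 0 ≤ t) (hκ : 0 < κ) {M : ℕ} (hM : 0 < M) :
    ∃ Φ : Code X H, Φ.size = M ∧
      Φ.error W ≤ prob (W.avg P) (specProj (W.avg P) (Set.Ici t)) + κ + M * t / κ := by
  choose T hT hTavg hTx using exists_unit_test hW P ht
  set E := specProj (W.avg P) (Set.Ici t) with hE
  have hEpos : E.IsPositive := isPositive_specProj _ _
  have hTpos : ∀ x, (T x).IsPositive := fun x =>
    ContinuousLinearMap.IsPositive.of_isStarProjection (hT x)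
  -- The bound for codeword `i` involves only codewords `j < i`, so extending the list never spoils
  -- earlier bounds; each new letter is picked no worse than the average.
  have hseq : ∀ k : ℕ, ∃ x : ℕ → X, ∀ i < k, prob (W.out (x i)) E +
      (∑ j ∈ Finset.range i, prob (W.out (x i)) (T (x j))) / κ
        ≤ prob (W.avg P) E + i * t / κ := by
    intro k
    induction k with
    | zero =>
      obtain ⟨x⟩ := P.nonempty
      exact ⟨fun _ => x, fun i hi => absurd hi (Nat.not_lt_zero i)⟩
    | succ k ih =>
      obtain ⟨x, hx⟩ := ih
      have hi : Integrable (fun y => prob (W.out y) E +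
          (∑ j ∈ Finset.range k, prob (W.out y) (T (x j))) / κ) (P : Measure X) :=
        (integrable_prob W hW P hEpos).add ((integrable_finsetSum _ fun j _ =>
          integrable_prob W hW P (hTpos (x j))).div_const κ)
      obtain ⟨y, hy⟩ := exists_le_integral hi
      have hint : ∫ y, (prob (W.out y) E +
          (∑ j ∈ Finset.range k, prob (W.out y) (T (x j))) / κ) ∂(P : Measure X) ≤
          prob (W.avg P) E + k * t / κ := by
        rw [integral_add (integrable_prob W hW P hEpos) ((integrable_finsetSum _ fun j _ =>
          integrable_prob W hW P (hTpos (x j))).div_const κ), integral_div,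
          integral_finsetSum _ fun j _ => integrable_prob W hW P (hTpos (x j)),
          ← prob_avg W hW P hEpos]
        gcongr
        calc _ ≤ ∑ j ∈ Finset.range k, t := Finset.sum_le_sum fun j _ => by
              rw [← prob_avg W hW P (hTpos (x j))]
              exact hTavg (x j)
          _ = _ := by simp
      refine ⟨Function.update x k y, fun i hik => ?_⟩
      have hlt : ∀ j ∈ Finset.range i, Function.update x k y j = x j := fun j hj =>
        Function.update_of_ne (by have := Finset.mem_range.1 hj; omega) _ _
      rw [Finset.sum_congr rfl fun j hj => by rw [hlt j hj]]
      rcases (Nat.lt_succ_iff.1 hik).eq_or_lt with h | h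
      · rw [h, Function.update_self]
        exact hy.trans hint
      · rw [Function.update_of_ne h.ne]
        exact hx i h
  obtain ⟨x, hx⟩ := hseq M
  refine exists_code_of_isStarProjection hW hM x (fun j => hT (x j)) hκ fun i hi => ?_
  have h1 := hx i hi
  have h2 := hTx (x i)
  have h3 : (i : ℝ) * t / κ ≤ M * t / κ := by gcongr
  linarith

end Codes

/-! ### The converse bound for a single code. -/

section Converse

variable {H : Type*} [NormedAddCommGroup H] [InnerProductSpace ℂ H] [CompleteSpace H]

theorem exists_re_inner_eq_norm_sq {Y : H →L[ℂ] H} (hY : Y.IsPositive) :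
    ∃ B : H →L[ℂ] H, ∀ v, (⟪v, Y v⟫_ℂ).re = ‖B v‖ ^ 2 := by
  obtain ⟨B, rfl⟩ := CStarAlgebra.nonneg_iff_eq_star_mul_self.1
    ((ContinuousLinearMap.nonneg_iff_isPositive Y).2 hY)
  refine ⟨B, fun v => ?_⟩
  rw [mul_apply_eq_comp, ContinuousLinearMap.star_eq_adjoint,
    ContinuousLinearMap.adjoint_inner_right, inner_self_eq_norm_sq_to_K]
  exact_mod_cast Complex.ofReal_re _

/-- Young's inequality for the cross term after writing `Y = B* B`. -/
theorem re_inner_add_le {Y : H →L[ℂ] H} (hY : Y.IsPositive) {κ : ℝ} (hκ : 0 < κ) (u v : H) :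
    (⟪u + v, Y (u + v)⟫_ℂ).re ≤
      (1 + κ⁻¹) * (⟪u, Y u⟫_ℂ).re + (1 + κ) * (⟪v, Y v⟫_ℂ).re := by
  obtain ⟨B, hB⟩ := exists_re_inner_eq_norm_sq hY
  rw [hB, hB, hB, map_add]
  have h1 : ‖B u + B v‖ ^ 2 ≤ (‖B u‖ + ‖B v‖) ^ 2 :=
    pow_le_pow_left₀ (norm_nonneg _) (norm_add_le _ _) 2
  have h2 : (1 + κ⁻¹) * ‖B u‖ ^ 2 + (1 + κ) * ‖B v‖ ^ 2 - (‖B u‖ + ‖B v‖) ^ 2 =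
      κ⁻¹ * (‖B u‖ - κ * ‖B v‖) ^ 2 := by field_simp; ring
  have h3 : 0 ≤ κ⁻¹ * (‖B u‖ - κ * ‖B v‖) ^ 2 := by positivity
  linarith

theorem re_inner_sum_smul_le {Y : H →L[ℂ] H} (hY : Y.IsPositive) {ι : Type*} [Fintype ι]
    (f : ι → H) (c : ι → ℂ) :
    (⟪∑ k, c k • f k, Y (∑ k, c k • f k)⟫_ℂ).re ≤
      (∑ k, ‖c k‖ ^ 2) * ∑ k, (⟪f k, Y (f k)⟫_ℂ).re := by
  obtain ⟨B, hB⟩ := exists_re_inner_eq_norm_sq hY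
  simp_rw [hB]
  refine le_trans ?_ (Finset.sum_mul_sq_le_sq_mul_sq Finset.univ (fun k => ‖c k‖)
    fun k => ‖B (f k)‖)
  refine pow_le_pow_left₀ (norm_nonneg _) ?_ 2
  rw [map_sum]
  refine (norm_sum_le _ _).trans (Finset.sum_le_sum fun k _ => ?_)
  rw [map_smul, norm_smul]

theorem Code.re_inner_decoder_le {X : Type*} (Φ : Code X H) (i : Fin Φ.size) (v : H) :
    (⟪v, Φ.decoder i v⟫_ℂ).re ≤ ‖v‖ ^ 2 := by
  have h1 : ∑ j, (⟪v, Φ.decoder j v⟫_ℂ).re = ‖v‖ ^ 2 := by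
    rw [← Complex.re_sum, ← inner_sum, ← sum_apply, Φ.decoder_sum,
      one_apply_eq_self, inner_self_eq_norm_sq_to_K]
    exact_mod_cast Complex.ofReal_re _
  rw [← h1]
  exact Finset.single_le_sum (f := fun j => (⟪v, Φ.decoder j v⟫_ℂ).re)
    (fun j _ => (Φ.decoder_isPositive j).re_inner_nonneg_right v) (Finset.mem_univ i)

variable {X : Type*} [MeasurableSpace X] {W : Channel X H}

/-- Each `f k` contributes at least `t` to the trace of `W_P`, while Bessel bounds the total by `1`
for every pure output. -/
theorem card_mul_le_one_of_orthonormal (hW : ∀ x, IsPureState (W.out x))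
    (P : ProbabilityMeasure X) {t : ℝ} {ι : Type*} (s : Finset ι) {f : ι → H}
    (hf : Orthonormal ℂ f)
    (hfm : ∀ k, f k ∈ (spectralSpan (W.avg P) (Set.Ici t)).topologicalClosure) :
    (s.card : ℝ) * t ≤ 1 := by
  have hi : ∀ k, Integrable (fun x => (⟪f k, W.out x (f k)⟫_ℂ).re) (P : Measure X) := fun k =>
    (((W.integrable_out hW P).apply_continuousLinearMap (f k)).const_inner (𝕜 := ℂ) (f k)).re
  calc (s.card : ℝ) * t = ∑ k ∈ s, t := by simp
    _ ≤ ∑ k ∈ s, (⟪f k, W.avg P (f k)⟫_ℂ).re := Finset.sum_le_sum fun k _ => by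
        have h := le_re_inner_apply_of_mem_closure (avg_isSymmetric W hW P) (t := t)
          (fun x hx => hx) (hfm k)
        rwa [hf.1 k, one_pow, mul_one] at h
    _ = ∫ x, ∑ k ∈ s, (⟪f k, W.out x (f k)⟫_ℂ).re ∂(P : Measure X) := by
        rw [integral_finsetSum _ fun k _ => hi k]
        exact Finset.sum_congr rfl fun k _ => re_inner_avg_self W hW P (f k)
    _ ≤ ∫ x, (1 : ℝ) ∂(P : Measure X) := by
        refine integral_mono (integrable_finsetSum _ fun k _ => hi k) (integrable_const _)
          fun x => ?_
        obtain ⟨ψ, hψ, h⟩ := hW x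
        simp only [h, re_inner_rankOne_self]
        have h2 := hf.sum_inner_products_le ψ (s := s)
        rw [hψ, one_pow] at h2
        refine le_trans (Finset.sum_le_sum fun k _ => ?_) h2
        rw [norm_inner_symm]
    _ = 1 := by simp

theorem exists_orthonormal_specProj_eq_sum (hW : ∀ x, IsPureState (W.out x))
    (P : ProbabilityMeasure X) {t : ℝ} (ht : 0 < t) :
    ∃ (n : ℕ) (f : Fin n → H), (n : ℝ) * t ≤ 1 ∧ Orthonormal ℂ f ∧
      ∀ v, specProj (W.avg P) (Set.Ici t) v =
        ∑ k, ⟪f k, specProj (W.avg P) (Set.Ici t) v⟫_ℂ • f k := by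
  set V := (spectralSpan (W.avg P) (Set.Ici t)).topologicalClosure with hV
  have hVc : CompleteSpace V := Submodule.topologicalClosure.completeSpace _
  have hfin : FiniteDimensional ℂ V := by
    obtain ⟨w, b, -⟩ := exists_hilbertBasis ℂ V
    have hb : Orthonormal ℂ fun k => (b k : H) := b.orthonormal.comp_linearIsometry V.subtypeₗᵢ
    have hw : Finite w := by
      by_contra hinf
      rw [not_finite_iff_infinite] at hinf
      obtain ⟨n, hn⟩ := exists_nat_gt (1 / t)
      obtain ⟨s, hs⟩ := Infinite.exists_subset_card_eq w n
      have h := card_mul_le_one_of_orthonormal hW P s hb fun k => (b k).2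
      rw [hs, ← le_div_iff₀ ht] at h
      linarith
    have := Fintype.ofFinite w
    exact b.toOrthonormalBasis.toBasis.finiteDimensional_of_finite
  let b := stdOrthonormalBasis ℂ V
  have hb : Orthonormal ℂ fun k => (b k : H) := b.orthonormal.comp_linearIsometry V.subtypeₗᵢ
  refine ⟨_, fun k => (b k : H), ?_, hb, fun v => ?_⟩
  · simpa using card_mul_le_one_of_orthonormal hW P Finset.univ hb fun k => (b k).2
  · have h := congrArg (Subtype.val) (b.sum_repr' ⟨_, specProj_apply_mem _ _ v⟩)
    simpa using h.symm

/-- The pushforward of the uniform law on messages. Singletons of `X` need not be measurable, hence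
the restriction on `f`. -/
theorem exists_probabilityMeasure_integral_eq {M : ℕ} (hM : 0 < M) (φ : Fin M → X) :
    ∃ P : ProbabilityMeasure X, ∀ f : X → ℝ, StronglyMeasurable f →
      ∫ x, f x ∂(P : Measure X) = 1 / (M : ℝ) * ∑ i, f (φ i) := by
  have : Nonempty (Fin M) := ⟨⟨0, hM⟩⟩
  have hφ : Measurable φ := measurable_of_finite φ
  refine ⟨⟨(PMF.uniformOfFintype (Fin M)).toMeasure.map φ,
    Measure.isProbabilityMeasure_map hφ.aemeasurable⟩, fun f hf => ?_⟩
  rw [ProbabilityMeasure.coe_mk, integral_map hφ.aemeasurable hf.aestronglyMeasurable,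
    PMF.integral_eq_sum, Finset.mul_sum]
  simp

/-- Converse bound for pure channels: the input distribution uniform on the codewords has an
averaged output with little weight on large eigenvalues, if the code is large. -/
theorem exists_prob_specProj_le_error (hW : ∀ x, IsPureState (W.out x)) (Φ : Code X H) :
    ∃ P : ProbabilityMeasure X, ∀ t κ : ℝ, 0 < t → 0 < κ →
      prob (W.avg P) (specProj (W.avg P) (Set.Ici t)) ≤
        Φ.error W + κ + (1 + κ⁻¹) / (Φ.size * t) := by
  obtain ⟨P, hP⟩ := exists_probabilityMeasure_integral_eq Φ.size_pos Φ.encoder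
  refine ⟨P, fun t κ ht hκ => ?_⟩
  have hM : (0 : ℝ) < Φ.size := by exact_mod_cast Φ.size_pos
  obtain ⟨n, f, hn, hf, hE⟩ := exists_orthonormal_specProj_eq_sum hW P ht
  rw [prob_avg W hW P (isPositive_specProj _ _),
    hP _ (W.stronglyMeasurable_prob hW (isPositive_specProj _ _))]
  set E := specProj (W.avg P) (Set.Ici t) with hEdef
  have key : ∀ i, prob (W.out (Φ.encoder i)) E ≤
      prob (W.out (Φ.encoder i)) (1 - Φ.decoder i) + κ +
        (1 + κ⁻¹) * ∑ k, (⟪f k, Φ.decoder i (f k)⟫_ℂ).re := by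
    intro i
    rw [prob_one_sub (hW _)]
    obtain ⟨ψ, hψ, h⟩ := hW (Φ.encoder i)
    have hY := Φ.decoder_isPositive i
    rw [h, prob_rankOne_specProj, prob_rankOne]
    -- The component off `E` succeeds with probability at most `1 - ‖E ψ‖²`; the component in `E` is
    -- bounded by the trace of the decoder element over the range of `E`.
    have h1 := re_inner_add_le hY hκ (E ψ) (ψ - E ψ)
    rw [add_sub_cancel] at h1
    have h2 := Φ.re_inner_decoder_le i (ψ - E ψ)
    have h3 : ‖ψ - E ψ‖ ^ 2 = 1 - ‖E ψ‖ ^ 2 := by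
      rw [hEdef, norm_sub_specProj_sq, hψ]; norm_num
    have h4 : (⟪E ψ, Φ.decoder i (E ψ)⟫_ℂ).re ≤ ∑ k, (⟪f k, Φ.decoder i (f k)⟫_ℂ).re := by
      have h5 := re_inner_sum_smul_le hY f fun k => ⟪f k, E ψ⟫_ℂ
      rw [← hE ψ] at h5
      refine h5.trans (mul_le_of_le_one_left
        (Finset.sum_nonneg fun k _ => hY.re_inner_nonneg_right _) ?_)
      refine (hf.sum_inner_products_le (E ψ)).trans ?_
      exact pow_le_one₀ (norm_nonneg _) (hψ ▸ norm_specProj_le _ _ ψ)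
    have h6 : 0 < κ⁻¹ := inv_pos.2 hκ
    nlinarith [sq_nonneg ‖E ψ‖, mul_le_mul_of_nonneg_left h4 (by linarith : 0 ≤ 1 + κ⁻¹),
      mul_le_mul_of_nonneg_left h2 (by linarith : 0 ≤ 1 + κ), mul_nonneg hκ.le (sq_nonneg ‖E ψ‖)]
  have hsum : ∑ i, ∑ k, (⟪f k, Φ.decoder i (f k)⟫_ℂ).re = n := by
    rw [Finset.sum_comm]
    have : ∀ k, ∑ i, (⟪f k, Φ.decoder i (f k)⟫_ℂ).re = 1 := fun k => by
      rw [← Complex.re_sum, ← inner_sum, ← sum_apply, Φ.decoder_sum,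
        one_apply_eq_self, inner_self_eq_norm_sq_to_K, hf.1 k]
      simp
    simp [this]
  have h1 := Finset.sum_le_sum fun i (_ : i ∈ Finset.univ) => key i
  rw [Finset.sum_add_distrib, Finset.sum_add_distrib, ← Finset.mul_sum, hsum, Finset.sum_const,
    Finset.card_univ, Fintype.card_fin, nsmul_eq_mul] at h1
  have h2 := mul_le_mul_of_nonneg_left h1 (by positivity : 0 ≤ 1 / (Φ.size : ℝ))
  refine h2.trans ?_
  rw [mul_add, mul_add, Code.error]
  have h3 : 1 / (Φ.size : ℝ) * (Φ.size * κ) = κ := by field_simp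
  have h4 : 1 / (Φ.size : ℝ) * ((1 + κ⁻¹) * n) ≤ (1 + κ⁻¹) / (Φ.size * t) := by
    have h5 : (n : ℝ) ≤ 1 / t := (le_div_iff₀ ht).2 hn
    calc 1 / (Φ.size : ℝ) * ((1 + κ⁻¹) * n) ≤ 1 / (Φ.size : ℝ) * ((1 + κ⁻¹) * (1 / t)) := by
          gcongr
      _ = _ := by field_simp
  linarith

end Converse

/-! ### The capacity formula. -/

section Capacity

variable {X : ℕ → Type*} [∀ N, MeasurableSpace (X N)] {H : ℕ → Type*}
  [∀ N, NormedAddCommGroup (H N)] [∀ N, InnerProductSpace ℂ (H N)] [∀ N, CompleteSpace (H N)]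
  {W : ∀ N, Channel (X N) (H N)}

theorem capacity_le_iSup_supEntropySpectrum {a : ℕ → ℝ} (ha : Tendsto a atTop atTop)
    (hW : ∀ N x, IsPureState ((W N).out x)) (ε : ℝ) :
    capacity a ε W ≤
      ⨆ P : ∀ N, ProbabilityMeasure (X N), supEntropySpectrum a ε (fun N => (W N).avg (P N)) := by
  refine sSup_le ?_
  rintro _ ⟨Φ, ⟨l, hl, hΦ⟩, rfl⟩
  choose P hP using fun N => exists_prob_specProj_le_error (hW N) (Φ N)
  refine le_trans (le_of_forall_lt fun z hz => ?_) (le_iSup _ P)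
  obtain ⟨r, hr1, hr2⟩ := EReal.lt_iff_exists_real_btwn.1 hz
  obtain ⟨b, hb1, hb2⟩ := EReal.lt_iff_exists_real_btwn.1 hr2
  have hδ : 0 < b - r := sub_pos.2 (by exact_mod_cast hb1)
  refine hr1.trans_le (le_sSup ⟨r, rfl, limsup_coe_le_iff.2 fun η hη => ?_⟩)
  -- With `t = exp (-a r)`, `κ = k` and `M ≥ exp (a b)`, one has `M t ≥ k⁻²`, so the excess is at
  -- most `k + (k² + k) ≤ 3 k`.
  have hlim : Tendsto (fun N => (Φ N).error (W N) + 3 * Real.exp (-(a N * ((b - r) / 2)))) atTop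
      (𝓝 l) := by
    simpa using hΦ.add ((tendsto_exp_neg_mul ha (half_pos hδ)).const_mul 3)
  filter_upwards [ha.eventually_gt_atTop 0, eventually_lt_of_lt_liminf hb2,
    hlim.eventually_le_const (by linarith : l < ε + η)] with N haN hbN hN
  rw [setOf_neg_log_le haN]
  refine (hP N _ _ (Real.exp_pos _) (Real.exp_pos (-(a N * ((b - r) / 2))))).trans
    (le_trans ?_ hN)
  have hM : (0 : ℝ) < (Φ N).size := by exact_mod_cast (Φ N).size_pos
  have hsize : Real.exp (a N * b) ≤ (Φ N).size := by
    have h1 : b < Real.log (Φ N).size / a N := by exact_mod_cast hbN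
    rw [lt_div_iff₀ haN, mul_comm] at h1
    exact ((Real.lt_log_iff_exp_lt hM).1 h1).le
  set k := Real.exp (-(a N * ((b - r) / 2))) with hk
  have hk0 : 0 < k := Real.exp_pos _
  have hk1 : k ≤ 1 := Real.exp_le_one_iff.2 (by
    have := mul_pos haN (half_pos hδ); linarith)
  have hst : (k ^ 2)⁻¹ ≤ (Φ N).size * Real.exp (-(a N * r)) := by
    refine le_trans (le_of_eq ?_) (mul_le_mul_of_nonneg_right hsize (Real.exp_pos _).le)
    rw [hk, ← Real.exp_nat_mul, ← Real.exp_neg, ← Real.exp_add]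
    congr 1
    push_cast
    ring
  have h2 : (1 + k⁻¹) / ((Φ N).size * Real.exp (-(a N * r))) ≤ (1 + k⁻¹) * k ^ 2 := by
    rw [div_le_iff₀ (by positivity)]
    calc 1 + k⁻¹ = (1 + k⁻¹) * k ^ 2 * (k ^ 2)⁻¹ := by field_simp
      _ ≤ _ := by gcongr
  have h3 : (1 + k⁻¹) * k ^ 2 ≤ 2 * k := by
    have : (1 + k⁻¹) * k ^ 2 = k ^ 2 + k := by field_simp
    nlinarith
  linarith

theorem capacity_nonneg (hW : ∀ N x, IsPureState ((W N).out x)) (hX : ∀ N, Nonempty (X N))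
    (a : ℕ → ℝ) {ε : ℝ} (hε : 0 ≤ ε) : 0 ≤ capacity a ε W := by
  choose Φ hΦ1 hΦ0 using fun N => exists_code_error_eq_zero (hW N) (hX N).some
  refine le_sSup ⟨Φ, ⟨0, hε, ?_⟩, ?_⟩
  · simp [hΦ0]
  · simp [hΦ1]

theorem le_capacity_of_limsup_le {a : ℕ → ℝ} (ha : Tendsto a atTop atTop)
    (hW : ∀ N x, IsPureState ((W N).out x)) {ε : ℝ} (hε1 : ε < 1)
    (P : ∀ N, ProbabilityMeasure (X N)) {r b : ℝ} (hr : 0 < r) (hrb : r < b)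
    (hb : limsup (fun N => ((prob ((W N).avg (P N)) (specProj ((W N).avg (P N))
      {x : ℝ | 0 < x ∧ (-1 / a N) * Real.log x ≤ b}) : ℝ) : EReal)) atTop ≤ (ε : EReal)) :
    (r : EReal) ≤ capacity a ε W := by
  have hδ : 0 < b - r := sub_pos.2 hrb
  set k : ℕ → ℝ := fun N => Real.exp (-(a N * ((b - r) / 2))) with hk
  set M : ℕ → ℕ := fun N => ⌈Real.exp (a N * r)⌉₊ with hM
  have hM0 : ∀ N, 0 < M N := fun N => Nat.ceil_pos.2 (Real.exp_pos _)
  have hMexp : ∀ N, Real.exp (a N * r) ≤ M N := fun N => Nat.le_ceil _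
  -- Capacity requires a convergent error, so the error is raised to `ε` whenever it is smaller. The
  -- uniform decoder allows this once `1 - 1 / M ≥ ε`, which holds eventually because `r > 0` forces
  -- `M → ∞` and `ε < 1`.
  have hex : ∀ N, ∃ Φ : Code (X N) (H N), Φ.size = M N ∧
      Φ.error (W N) ≤ max ε (prob ((W N).avg (P N)) (specProj ((W N).avg (P N))
        (Set.Ici (Real.exp (-(a N * b))))) + k N + M N * Real.exp (-(a N * b)) / k N) ∧
      (ε ≤ 1 - 1 / (M N : ℝ) → ε ≤ Φ.error (W N)) := by
    intro N
    obtain ⟨Φ, h1, h2⟩ := exists_code_error_le (hW N) (P N) (Real.exp_pos (-(a N * b))).le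
      (Real.exp_pos (-(a N * ((b - r) / 2)))) (hM0 N)
    rcases le_or_gt ε (Φ.error (W N)) with h | h
    · exact ⟨Φ, h1, h2.trans (le_max_right _ _), fun _ => h⟩
    · by_cases h3 : ε ≤ 1 - 1 / (M N : ℝ)
      · obtain ⟨Ψ, h4, h5⟩ := exists_code_error_eq (hW N) Φ h.le (by rwa [h1])
        exact ⟨Ψ, h4.trans h1, h5.le.trans (le_max_left _ _), fun _ => h5.ge⟩
      · exact ⟨Φ, h1, h.le.trans (le_max_left _ _), fun h => absurd h h3⟩
  choose Φ hsize herr herr' using hex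
  have hk0 : Tendsto k atTop (𝓝 0) := tendsto_exp_neg_mul ha (half_pos hδ)
  have hMtop : Tendsto (fun N => 1 - 1 / (M N : ℝ)) atTop (𝓝 1) := by
    have h1 : Tendsto (fun N => (M N : ℝ)) atTop atTop :=
      tendsto_atTop_mono hMexp (Real.tendsto_exp_atTop.comp (ha.atTop_mul_const hr))
    simpa using (tendsto_const_nhds (x := (1 : ℝ))).sub
      ((tendsto_const_nhds (x := (1 : ℝ))).div_atTop h1)
  have hle : (r : EReal) ≤
      liminf (fun N => ((Real.log (Φ N).size / a N : ℝ) : EReal)) atTop := by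
    refine le_liminf_of_le (by isBoundedDefault) ?_
    filter_upwards [ha.eventually_gt_atTop 0] with N haN
    have h1 : r ≤ Real.log (M N) / a N := by
      rw [le_div_iff₀ haN, mul_comm]
      exact (Real.le_log_iff_exp_le (by exact_mod_cast hM0 N)).2 (hMexp N)
    rw [hsize N]
    exact_mod_cast h1
  refine hle.trans (le_sSup ⟨Φ, ⟨ε, le_rfl, ?_⟩, rfl⟩)
  refine tendsto_order.2 ⟨fun z hz => ?_, fun z hz => ?_⟩
  · filter_upwards [hMtop.eventually_const_le hε1] with N hN
    exact hz.trans_le (herr' N hN)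
  · have hη : 0 < (z - ε) / 3 := by linarith
    filter_upwards [ha.eventually_gt_atTop 0, limsup_coe_le_iff.1 hb _ hη,
      hk0.eventually_le_const (by linarith : (0 : ℝ) < (z - ε) / 10)] with N haN hN hkN
    rw [setOf_neg_log_le haN] at hN
    refine (herr N).trans_lt (max_lt hz ?_)
    have h1 : (M N : ℝ) ≤ 2 * Real.exp (a N * r) := by
      have h2 := Nat.ceil_lt_add_one (Real.exp_pos (a N * r)).le
      have h3 : 1 ≤ Real.exp (a N * r) := Real.one_le_exp (mul_pos haN hr).le
      have h4 : (M N : ℝ) < Real.exp (a N * r) + 1 := h2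
      linarith
    -- `k² = exp (-a (b - r))`; the factor `2` pays for rounding `M` up.
    have h5 : M N * Real.exp (-(a N * b)) / k N ≤ 2 * k N := by
      have hkp : 0 < k N := Real.exp_pos _
      rw [div_le_iff₀ hkp]
      calc M N * Real.exp (-(a N * b)) ≤ 2 * Real.exp (a N * r) * Real.exp (-(a N * b)) := by
            gcongr
        _ = 2 * k N * k N := by
            rw [hk, mul_assoc, mul_assoc, ← Real.exp_add, ← Real.exp_add]
            congr 2
            ring
    linarith

theorem supEntropySpectrum_le_capacity {a : ℕ → ℝ} (ha : Tendsto a atTop atTop)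
    (hW : ∀ N x, IsPureState ((W N).out x)) {ε : ℝ} (hε0 : 0 ≤ ε) (hε1 : ε < 1)
    (P : ∀ N, ProbabilityMeasure (X N)) :
    supEntropySpectrum a ε (fun N => (W N).avg (P N)) ≤ capacity a ε W := by
  refine sSup_le ?_
  rintro _ ⟨b, rfl, hb⟩
  refine le_of_forall_lt_imp_le_of_dense fun z hz => ?_
  obtain ⟨r, hr1, hr2⟩ := EReal.lt_iff_exists_real_btwn.1 hz
  refine hr1.le.trans ?_
  -- For `r ≤ 0` the codes need not grow, and one-message codes with zero error already suffice.
  rcases le_or_gt r 0 with h | h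
  · exact le_trans (by exact_mod_cast h) (capacity_nonneg hW (fun N => (P N).nonempty) a hε0)
  · exact le_capacity_of_limsup_le ha hW hε1 P h (by exact_mod_cast hr2) hb

end Capacity

end CQ

theorem theorem3
    {X : ℕ → Type*} [∀ N, MeasurableSpace (X N)]
    {H : ℕ → Type*} [∀ N, NormedAddCommGroup (H N)] [∀ N, InnerProductSpace ℂ (H N)]
    [∀ N, CompleteSpace (H N)]
    (a : ℕ → ℝ) (ha : Tendsto a atTop atTop)
    (W : ∀ N, CQ.Channel (X N) (H N))
    (hW : ∀ N x, CQ.IsPureState ((W N).out x))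
    (ε : ℝ) (hε0 : 0 ≤ ε) (hε1 : ε < 1) :
    (∀ P : ∀ N, ProbabilityMeasure (X N),
      CQ.infoSpectrum a ε P W = CQ.supEntropySpectrum a ε (fun N => (W N).avg (P N))) ∧
    CQ.capacity a ε W =
      ⨆ P : ∀ N, ProbabilityMeasure (X N),
        CQ.supEntropySpectrum a ε (fun N => (W N).avg (P N)) := by
  exact ⟨fun P => CQ.infoSpectrum_eq_supEntropySpectrum ha hW ε P,
    le_antisymm (CQ.capacity_le_iSup_supEntropySpectrum ha hW ε)
      (iSup_le fun P => CQ.supEntropySpectrum_le_capacity ha hW hε0 hε1 P)⟩
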